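/- Let $q>2$ be a prime power, let $H_\infty\cong\mathrm{PG}(n,q)$ be a hyperplane of $\mathrm{PG}(n+1,q)$, and for a point set $\mathcal K$ of $H_\infty$ let $T_n^*(\mathcal K)$ be its linear representation: the point-line incidence structure whose points are the points of $\mathrm{PG}(n+1,q)\setminus H_\infty$ and whose lines are the lines of $\mathrm{PG}(n+1,q)$ meeting $H_\infty$ exactly in a point of $\mathcal K$, with natural incidence. A frame of $\mathrm{PG}(n,q)$ is a set of $n+2$ points any $n+1$ of which span $\mathrm{PG}(n,q)$. An $n$-dimensional subgeometry of $\mathrm{PG}(n,q)$ is the set of points that have homogeneous coordinates in a subfield $\mathbb F_{q_0}$ of $\mathbb F_q$ with respect to some fixed frame. The closure $\overline{\mathcal K}$ of a point set $\mathcal K$ containing a frame is the smallest $n$-dimensional subgeometry containing $\mathcal K$. A point set $\mathcal K$ has Property $(*)$ if no plane of $\mathrm{PG}(n,q)$ meets $\mathcal K$ exactly in two intersecting lines, or exactly in two intersecting lines minus their intersection point. Let $\mathcal K$ and $\mathcal K'$ be point sets of $H_\infty$, each containing a frame of $H_\infty$, with closures $\mathcal S=\overline{\mathcal K}$ and $\mathcal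 S'=\overline{\mathcal K'}$. If $\mathcal S=H_\infty$, suppose further that $\mathcal K$ has Property $(*)$. Then every isomorphism $\gamma$ from $T_n^*(\mathcal K)$ to $T_n^*(\mathcal K')$ is induced by an isomorphism $\delta$ from $T_n^*(\mathcal S)$ to $T_n^*(\mathcal S')$ that maps $\mathcal S$ onto $\mathcal S'$. That is, $\delta$ agrees with $\gamma$ on all points of $\mathrm{PG}(n+1,q)\setminus H_\infty$ and on all lines of $T_n^*(\mathcal K)$, and there is a bijection $\varphi:\mathcal S\to\mathcal S'$, preserving collinearity of points in both directions, such that for every $P\in\mathcal S$ a line of $T_n^*(\mathcal S)$ meets $H_\infty$ in $P$ if and only if its image under $\delta$ meets $H_\infty$ in $\varphi(P)$. -/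

import Mathlib

open scoped LinearAlgebra.Projectivization

namespace LinRep

section ProjectiveSpace

variable {F : Type*} [Field F] {W : Type*} [AddCommGroup W] [Module F W]

/-- The points of `PG(W)` lying on the projective subspace given by the vector subspace `U`. -/
def pts (U : Submodule F W) : Set (ℙ F W) :=
  {P | P.submodule ≤ U}

/-- Three points lie on a common projective line. -/
def Collinear (P Q R : ℙ F W) : Prop :=
  ∃ l : Submodule F W, Module.finrank F l = 2 ∧ P ∈ pts l ∧ Q ∈ pts l ∧ R ∈ pts l

/-- With `dim W = n + 1`, a frame of `PG(W) = PG(n, F)` is a set of `n + 2` points such that any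
`n + 1` of them span the whole space. -/
def IsFrame (A : Set (ℙ F W)) : Prop :=
  A.Finite ∧ A.ncard = Module.finrank F W + 1 ∧
    ∀ B ⊆ A, B.ncard = Module.finrank F W → (⨆ P ∈ B, P.submodule) = ⊤

/-- The points having a coordinate vector with entries in the subfield `F₀`, with respect to
the basis `b` (equivalently, with respect to the frame consisting of the points of the basis
vectors and the point of their sum). -/
def subfieldPoints (F₀ : Subfield F) (b : Module.Basis (Fin (Module.finrank F W)) F W) :
    Set (ℙ F W) :=
  {P | ∃ v : W, v ≠ 0 ∧ v ∈ P.submodule ∧ ∀ i, b.repr v i ∈ F₀}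

/-- With `dim W = n + 1`, an `n`-dimensional subgeometry of `PG(W)`. -/
def IsSubgeometry (X : Set (ℙ F W)) : Prop :=
  ∃ (F₀ : Subfield F) (b : Module.Basis (Fin (Module.finrank F W)) F W),
    X = subfieldPoints F₀ b

/-- `K` contains a frame, and `S` is its closure: the smallest `n`-dimensional subgeometry
containing `K`. -/
def IsClosure (K S : Set (ℙ F W)) : Prop :=
  (∃ A ⊆ K, IsFrame A) ∧ IsLeast {X : Set (ℙ F W) | IsSubgeometry X ∧ K ⊆ X} S

/-- Property (*): no plane meets `K` exactly in two intersecting lines, or exactly in two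
intersecting lines minus their intersection point. (Distinct lines in a plane always meet.) -/
def PropertyStar (K : Set (ℙ F W)) : Prop :=
  ∀ π l m : Submodule F W, Module.finrank F π = 3 → Module.finrank F l = 2 →
    Module.finrank F m = 2 → l ≤ π → m ≤ π → l ≠ m →
    K ∩ pts π ≠ pts l ∪ pts m ∧ K ∩ pts π ≠ (pts l ∪ pts m) \ pts (l ⊓ m)

end ProjectiveSpace

/-- An isomorphism of point-line incidence structures, given by their incidence relations. -/
structure IncidenceIso {P L P' L' : Type*} (I : P → L → Prop) (I' : P' → L' → Prop) where
  onPoints : P ≃ P'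
  onLines : L ≃ L'
  inc_iff : ∀ p l, I' (onPoints p) (onLines l) ↔ I p l

section LinearRepresentation

variable {F : Type*} [Field F] {V : Type*} [AddCommGroup V] [Module F V]

/-- The affine points: the points of `PG(V)` off the hyperplane at infinity `PG(H)`. -/
def AffinePoint (H : Submodule F V) : Type _ :=
  {p : ℙ F V // p ∉ pts H}

/-- The projective line given by `L` meets the hyperplane `PG(H)` exactly in the point `P`. -/
def MeetsInfinityAt (H : Submodule F V) (L : Submodule F V) (P : ℙ F H) : Prop :=
  L ⊓ H = P.submodule.map H.subtype

/-- The lines of the linear representation of `K`: the lines of `PG(V)` meeting `PG(H)`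
exactly in a point of `K`. -/
def RepLine (H : Submodule F V) (K : Set (ℙ F H)) : Type _ :=
  {L : Submodule F V // Module.finrank F L = 2 ∧ ∃ P ∈ K, MeetsInfinityAt H L P}

/-- Natural incidence between the points and lines of the linear representation of `K`. -/
def Inc (H : Submodule F V) (K : Set (ℙ F H)) (p : AffinePoint H) (L : RepLine H K) : Prop :=
  p.1 ∈ pts L.1

/-- Isomorphisms from the linear representation of `K` to that of `K'`. -/
abbrev LinRepIso (H : Submodule F V) (K K' : Set (ℙ F H)) : Type _ :=
  IncidenceIso (Inc H K) (Inc H K')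

/-- `γ` is induced by `δ`: on points they agree, and each line of the domain of `γ` is a line of
the domain of `δ` and has the same image under both. -/
def IsInducedBy {H : Submodule F V} {K K' S S' : Set (ℙ F H)}
    (γ : LinRepIso H K K') (δ : LinRepIso H S S') : Prop :=
  (∀ p : AffinePoint H, γ.onPoints p = δ.onPoints p) ∧
    ∀ L : RepLine H K, ∃ M : RepLine H S, M.1 = L.1 ∧ (δ.onLines M).1 = (γ.onLines L).1

/-- `δ` maps `S` onto `S'`: there is a bijection `φ` from `S` onto `S'`, preserving collinearity in
both directions, such that `δ` maps the lines through a point `P` of `S` to the lines through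
`φ P`. -/
def MapsInfinityOnto {H : Submodule F V} {S S' : Set (ℙ F H)} (δ : LinRepIso H S S') : Prop :=
  ∃ φ : S ≃ S',
    (∀ (L : RepLine H S) (P : S),
      MeetsInfinityAt H (δ.onLines L).1 (φ P : ℙ F H) ↔ MeetsInfinityAt H L.1 (P : ℙ F H)) ∧
    ∀ P Q R : S, Collinear (φ P : ℙ F H) (φ Q : ℙ F H) (φ R : ℙ F H) ↔
      Collinear (P : ℙ F H) (Q : ℙ F H) (R : ℙ F H)

end LinearRepresentation

end LinRep

/-! Fix a vector off the hyperplane. The affine points become the vectors of `H`, and a line of the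
representation becomes a coset of the one-dimensional space of a point of `K`. The isomorphism is
then a bijection `τ` of `H` sending lines with direction in `K` to lines with direction in `K'`, and
likewise backwards.

Parallelism is the first hurdle. Take parallel lines in a plane covered by two families of such
lines. If their images are not parallel, the image of the plane is a hyperbolic paraboloid `x + a e₁
+ b e₂ + ab f` (`IsGrid.exists_paraboloid`). Its two rulings supply as directions all points of two
lines at infinity, except perhaps their common point `f`. Any other direction in their plane is that
of a line with exactly two points on the paraboloid; its preimage would have two points in a plane
without lying in it. So the plane at infinity meets the direction set in precisely the configuration
that Property (*) forbids. A proper subgeometry contains no line minus a point, which settles the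
case `S ≠ H_∞`. The hypothesis concerns `K` alone, so this argument is run for `τ⁻¹`.

Since frames span, a map preserving parallelism sends parallelograms to parallelograms, so `τ` is an
additive map `t` followed by a translation (`map_add_sub_of_parallel`).

The map `t` need not be semilinear. In coordinates given by a frame in `K` it acts through one
additive bijection `g` of `F`, and the scalars `r` with `g (a r) = g a * g r` for all `a` form a
subfield `R`. The points of `K` are `R`-rational, hence so is the closure `S`, and on `R`-rational
vectors `t` does behave semilinearly. It therefore carries `S` to a subgeometry containing `K'`, and
minimality of `S'`, used in both directions, gives `t(S) = S'` (`exists_preimage_of_isClosure`). -/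

namespace LinRep

/-! ### Points as one-dimensional subspaces. -/

section Points

variable {F : Type*} [Field F] {E : Type*} [AddCommGroup E] [Module F E]

theorem exists_ne_zero_mem (P : ℙ F E) : ∃ v : E, v ≠ 0 ∧ v ∈ P.submodule :=
  ⟨P.rep, P.rep_nonzero, by rw [P.submodule_eq]; exact Submodule.mem_span_singleton_self _⟩

theorem submodule_eq_span {P : ℙ F E} {v : E} (hv : v ≠ 0) (h : v ∈ P.submodule) :
    P.submodule = Submodule.span F {v} := by
  rw [P.submodule_eq, Submodule.mem_span_singleton] at h
  obtain ⟨a, rfl⟩ := h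
  rw [P.submodule_eq, Submodule.span_singleton_smul_eq]
  exact (left_ne_zero_of_smul hv).isUnit

theorem mem_submodule_iff_smul {P : ℙ F E} {v : E} (hv : v ≠ 0) (h : v ∈ P.submodule) {w : E} :
    w ∈ P.submodule ↔ ∃ c : F, w = c • v := by
  rw [submodule_eq_span hv h, Submodule.mem_span_singleton]
  exact exists_congr fun _ => eq_comm

theorem point_eq_of_mem {P Q : ℙ F E} {v : E} (hv : v ≠ 0) (hP : v ∈ P.submodule)
    (hQ : v ∈ Q.submodule) : P = Q :=
  Projectivization.submodule_injective
    ((submodule_eq_span hv hP).trans (submodule_eq_span hv hQ).symm)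

theorem mem_mk {v : E} (hv : v ≠ 0) : v ∈ (Projectivization.mk F v hv).submodule := by
  rw [Projectivization.submodule_mk]; exact Submodule.mem_span_singleton_self _

/-- The vector `v` lies in the one-dimensional subspace of some point of `B`. -/
def IsDir (B : Set (ℙ F E)) (v : E) : Prop := ∃ T ∈ B, v ∈ T.submodule

/-- Linear independence of three vectors, spelled out. -/
def Indep (F : Type*) [Field F] {E : Type*} [AddCommGroup E] [Module F E] (u v w : E) : Prop :=
  ∀ a b c : F, a • u + b • v + c • w = 0 → a = 0 ∧ b = 0 ∧ c = 0

end Points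

/-! ### Skew grids are hyperbolic paraboloids. -/

section Saddle

variable {F : Type*} [Field F] {E : Type*} [AddCommGroup E] [Module F E]

/-- A grid of points whose rows and columns are affine lines with directions in `B`. -/
structure IsGrid (B : Set (ℙ F E)) (g : F → F → E) : Prop where
  inj : ∀ s t s' t', g s t = g s' t' → s = s' ∧ t = t'
  row : ∀ t, ∃ T ∈ B, ∀ y, y - g 0 t ∈ T.submodule ↔ ∃ s, g s t = y
  col : ∀ s, ∃ T ∈ B, ∀ y, y - g s 0 ∈ T.submodule ↔ ∃ t, g s t = y

/-- A grid with two nonparallel rows is a hyperbolic paraboloid. -/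
theorem IsGrid.exists_paraboloid {B : Set (ℙ F E)} {g : F → F → E} (hg : IsGrid B g)
    (hF : ∃ b : F, b ≠ 0 ∧ b ≠ 1) {t₀ : F} {T₀ T₁ : ℙ F E} (hT : T₀ ≠ T₁)
    (h0 : ∀ y, y - g 0 0 ∈ T₀.submodule ↔ ∃ s, g s 0 = y)
    (h1 : ∀ y, y - g 0 t₀ ∈ T₁.submodule ↔ ∃ s, g s t₀ = y) :
    ∃ x e₁ e₂ f : E, Indep F e₁ e₂ f ∧ (∀ b : F, IsDir B (e₁ + b • f)) ∧
      (∀ a : F, IsDir B (e₂ + a • f)) ∧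
      ∀ y, (∃ s t, g s t = y) ↔ ∃ a b : F, y = x + a • e₁ + b • e₂ + (a * b) • f := by
  obtain ⟨e₁, he₁, he₁T⟩ := exists_ne_zero_mem T₀
  obtain ⟨e₃, he₃, he₃T⟩ := exists_ne_zero_mem T₁
  obtain ⟨C, hCB, hC⟩ := hg.col 0
  have ht₀ : t₀ ≠ 0 := by
    rintro rfl
    obtain ⟨s, hs⟩ := (h0 (g 0 0 + e₁)).1 (by simpa using he₁T)
    have := (h1 _).2 ⟨s, hs⟩
    exact hT (point_eq_of_mem he₁ he₁T (by simpa using this))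
  obtain ⟨e₂, he₂⟩ : ∃ e, e = g 0 t₀ - g 0 0 := ⟨_, rfl⟩
  obtain ⟨x, hx⟩ : ∃ x, x = g 0 0 := ⟨_, rfl⟩
  rw [← hx] at he₂ h0 hC
  have hgt : g 0 t₀ = x + e₂ := by rw [he₂]; abel
  rw [hgt] at h1
  have he₂C : e₂ ∈ C.submodule := by rw [he₂]; exact (hC _).2 ⟨_, rfl⟩
  have he₂0 : e₂ ≠ 0 := by
    intro h
    rw [h, add_zero, hx] at hgt
    exact ht₀ (hg.inj _ _ _ _ hgt).2
  have hind : Indep F e₁ e₂ e₃ := by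
    intro a b c habc
    -- A relation with `b ≠ 0` would produce a common point of the rows `0` and `t₀`.
    have hb : b = 0 := by
      by_contra hb
      obtain ⟨s, hs⟩ := (h0 (x + (-(a / b)) • e₁)).1
        (by rw [add_sub_cancel_left]; exact Submodule.smul_mem _ _ he₁T)
      obtain ⟨s', hs'⟩ := (h1 (x + e₂ + (c / b) • e₃)).1
        (by rw [add_sub_cancel_left]; exact Submodule.smul_mem _ _ he₃T)
      have : b⁻¹ • (a • e₁ + b • e₂ + c • e₃) = 0 := by rw [habc, smul_zero]
      have h2 : x + (-(a / b)) • e₁ = x + e₂ + (c / b) • e₃ := by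
        rw [smul_add, smul_add, smul_smul, smul_smul, smul_smul, inv_mul_cancel₀ hb] at this
        rw [← sub_eq_zero, ← neg_eq_zero, ← this]
        module
      rw [← hs, ← hs'] at h2
      exact ht₀ (hg.inj _ _ _ _ h2).2.symm
    subst hb
    have hc : c = 0 := by
      by_contra hc
      refine hT (point_eq_of_mem he₃ ?_ he₃T)
      have : e₃ = (-(a / c)) • e₁ := by
        have : c⁻¹ • (a • e₁ + (0 : F) • e₂ + c • e₃) = 0 := by rw [habc, smul_zero]
        rw [smul_add, smul_add, smul_smul, smul_smul, smul_smul, inv_mul_cancel₀ hc] at this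
        rw [← sub_eq_zero, ← this]
        module
      rw [this]
      exact Submodule.smul_mem _ _ he₁T
    subst hc
    simpa [he₁] using habc
  have hcoord : ∀ a b c a' b' c' : F, a • e₁ + b • e₂ + c • e₃ = a' • e₁ + b' • e₂ + c' • e₃ →
      a = a' ∧ b = b' ∧ c = c' := by
    intro a b c a' b' c' h
    obtain ⟨h1, h2, h3⟩ := hind (a - a') (b - b') (c - c') (by
      rw [← sub_eq_zero.2 h]; module)
    exact ⟨sub_eq_zero.1 h1, sub_eq_zero.1 h2, sub_eq_zero.1 h3⟩
  -- The labels `s`, `t` of the grid carry no algebraic meaning; relabel by the affine coordinates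
  -- on row `0` and column `0`.
  choose sA hsA using fun a : F => (h0 (x + a • e₁)).1
    (by rw [add_sub_cancel_left]; exact Submodule.smul_mem _ _ he₁T)
  choose tB htB using fun b : F => (hC (x + b • e₂)).1
    (by rw [add_sub_cancel_left]; exact Submodule.smul_mem _ _ he₂C)
  have hsurjA : ∀ s, ∃ a, s = sA a := by
    intro s
    obtain ⟨a, ha⟩ := (mem_submodule_iff_smul he₁ he₁T).1 ((h0 _).2 ⟨s, rfl⟩)
    refine ⟨a, (hg.inj s 0 _ 0 ?_).1⟩
    rw [hsA, ← ha]; abel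
  have hsurjB : ∀ t, ∃ b, t = tB b := by
    intro t
    obtain ⟨b, hb⟩ := (mem_submodule_iff_smul he₂0 he₂C).1 ((hC _).2 ⟨t, rfl⟩)
    refine ⟨b, (hg.inj 0 t 0 _ ?_).2⟩
    rw [htB, ← hb]; abel
  have hs0 : sA 0 = 0 := (hg.inj _ 0 _ 0 (by rw [hsA, ← hx]; simp)).1
  have hinjA : ∀ a a', sA a = sA a' → a = a' := by
    intro a a' h
    have h2 := hsA a
    rw [h, hsA a'] at h2
    have h3 : (a' - a) • e₁ = 0 := by rw [sub_smul, sub_eq_zero]; exact add_left_cancel h2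
    rcases smul_eq_zero.1 h3 with h | h
    · exact (sub_eq_zero.1 h).symm
    · exact absurd h he₁
  have hinjB : ∀ a a', tB a = tB a' → a = a' := by
    intro a a' h
    have h2 := htB a
    rw [h, htB a'] at h2
    have h3 : (a' - a) • e₂ = 0 := by rw [sub_smul, sub_eq_zero]; exact add_left_cancel h2
    rcases smul_eq_zero.1 h3 with h | h
    · exact (sub_eq_zero.1 h).symm
    · exact absurd h he₂0
  have ht1 : tB 1 = t₀ := (hg.inj 0 _ 0 _ (by rw [htB, hgt, one_smul])).2
  have ht0 : tB 0 = 0 := (hg.inj 0 _ 0 _ (by rw [htB, ← hx]; simp)).2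
  choose c hc using fun s : F => (mem_submodule_iff_smul he₃ he₃T).1 ((h1 _).2 ⟨s, rfl⟩)
  have hc' : ∀ a, g (sA a) t₀ = x + e₂ + c (sA a) • e₃ := by
    intro a; rw [← hc]; abel
  -- Each column is the line joining its points on the rows `0` and `t₀`.
  have hlam : ∀ a b, ∃ l : F, g (sA a) (tB b) =
      x + a • e₁ + l • (e₂ + c (sA a) • e₃ - a • e₁) := by
    intro a b
    obtain ⟨D, -, hD⟩ := hg.col (sA a)
    rw [hsA] at hD
    have hm := (hD _).2 ⟨t₀, rfl⟩
    have hne : g (sA a) t₀ - (x + a • e₁) ≠ 0 := by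
      rw [sub_ne_zero, ← hsA]
      exact fun h => ht₀ (hg.inj _ _ _ _ h).2
    obtain ⟨l, hl⟩ := (mem_submodule_iff_smul hne hm).1 ((hD _).2 ⟨tB b, rfl⟩)
    refine ⟨l, ?_⟩
    rw [sub_eq_iff_eq_add'] at hl
    rw [hl, hc']
    module
  have hc1 : c (sA 1) ≠ 0 := by
    intro h
    have := hc' 1
    rw [h, zero_smul, add_zero, ← hgt, ← hs0] at this
    exact one_ne_zero (hinjA _ _ (hg.inj _ _ _ _ this).1)
  -- A third row forces the correspondence `c` between the first two to be linear; this needs an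
  -- element other than `0` and `1`.
  have hmain : ∀ b : F, b ≠ 0 → b ≠ 1 → ∀ a, c (sA a) = a * c (sA 1) ∧
      g (sA a) (tB b) = x + a • e₁ + b • (e₂ + c (sA a) • e₃ - a • e₁) := by
    intro b hb0 hb1 a
    choose l hl using hlam
    obtain ⟨T, -, hTb⟩ := hg.row (tB b)
    rw [htB] at hTb
    have hdiff : ∀ a, g (sA a) (tB b) - (x + b • e₂) =
        ((1 - l a b) * a) • e₁ + (l a b - b) • e₂ + (l a b * c (sA a)) • e₃ := by
      intro a; rw [hl]; module
    have hne : g (sA 1) (tB b) - (x + b • e₂) ≠ 0 := by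
      rw [sub_ne_zero, ← htB, ← hs0]
      exact fun h => one_ne_zero (hinjA _ _ (hg.inj _ _ _ _ h).1)
    have hk : ∀ a, ∃ k : F, (1 - l a b) * a = k * (1 - l 1 b) ∧ l a b - b = k * (l 1 b - b) ∧
        l a b * c (sA a) = k * (l 1 b * c (sA 1)) := by
      intro a
      obtain ⟨k, hk⟩ := (mem_submodule_iff_smul hne ((hTb _).2 ⟨_, rfl⟩)).1
        ((hTb (g (sA a) (tB b))).2 ⟨_, rfl⟩)
      refine ⟨k, hcoord _ _ _ _ _ _ ?_⟩
      rw [← hdiff, hk, hdiff]; module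
    have hl1 : l 1 b ≠ 1 := by
      intro h
      have := hl 1 b
      rw [h] at this
      have h3 : g (sA 1) (tB b) = g (sA 1) t₀ := by rw [this, hc']; module
      rw [← ht1] at h3
      exact hb1 (hinjB _ _ (hg.inj _ _ _ _ h3).2)
    have hl1' : (1 : F) - l 1 b ≠ 0 := sub_ne_zero.2 hl1.symm
    have hl1b : l 1 b = b := by
      by_contra hlb
      have hlb' : l 1 b - b ≠ 0 := sub_ne_zero.2 hlb
      -- Project along `e₃`. Column `a` has direction `(-a, 1)` and row `b` has direction `(1 - l 1
      -- b, l 1 b - b)`; this `a` makes them parallel. As they must meet, they coincide, and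
      -- comparing their points on column `0` gives `b = 1`.
      obtain ⟨k, hk1, hk2, -⟩ := hk (-((1 - l 1 b) / (l 1 b - b)))
      generalize l (-((1 - l 1 b) / (l 1 b - b))) b = m at hk1 hk2
      field_simp at hk1
      apply hb1
      linear_combination hk1 - hk2
    obtain ⟨k, hk1, hk2, hk3⟩ := hk a
    have hla : l a b = b := by
      rw [hl1b, sub_self, mul_zero] at hk2
      exact sub_eq_zero.1 hk2
    have hka : a = k := by
      rw [hla, hl1b, mul_comm] at hk1
      exact mul_right_cancel₀ (sub_ne_zero.2 hb1.symm) hk1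
    refine ⟨?_, by rw [hl, hla]⟩
    rw [hla, hl1b, ← hka] at hk3
    apply mul_left_cancel₀ hb0
    rw [hk3]; ring
  have hca : ∀ a, c (sA a) = a * c (sA 1) := by
    obtain ⟨b, hb0, hb1⟩ := hF
    exact fun a => (hmain b hb0 hb1 a).1
  have hG : ∀ a b, g (sA a) (tB b) =
      x + a • e₁ + b • e₂ + (a * b) • (c (sA 1) • e₃ - e₁) := by
    intro a b
    by_cases hb0 : b = 0
    · subst hb0; rw [ht0, hsA]; module
    by_cases hb1 : b = 1
    · subst hb1; rw [ht1, hc', hca a]; module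
    rw [(hmain b hb0 hb1 a).2, hca a]; module
  refine ⟨x, e₁, e₂, c (sA 1) • e₃ - e₁, ?_, ?_, ?_, ?_⟩
  · intro p q r h
    obtain ⟨h1, h2, h3⟩ := hind (p - r) q (r * c (sA 1)) (by rw [← h]; module)
    have hr := (mul_eq_zero.1 h3).resolve_right hc1
    exact ⟨by rw [hr, sub_zero] at h1; exact h1, h2, hr⟩
  · intro b
    obtain ⟨T, hTB, hTb⟩ := hg.row (tB b)
    refine ⟨T, hTB, ?_⟩
    have := (hTb _).2 ⟨sA 1, rfl⟩
    rw [htB, hG] at this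
    convert this using 1
    module
  · intro a
    obtain ⟨T, hTB, hTb⟩ := hg.col (sA a)
    refine ⟨T, hTB, ?_⟩
    have := (hTb _).2 ⟨tB 1, rfl⟩
    rw [hsA, hG] at this
    convert this using 1
    module
  · intro y
    constructor
    · rintro ⟨s, t, rfl⟩
      obtain ⟨a, rfl⟩ := hsurjA s
      obtain ⟨b, rfl⟩ := hsurjB t
      exact ⟨a, b, hG a b⟩
    · rintro ⟨a, b, rfl⟩
      exact ⟨_, _, hG a b⟩

end Saddle

/-! ### Preservation of parallelism. -/

section Parallelism

variable {F : Type*} [Field F] {E : Type*} [AddCommGroup E] [Module F E]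

/-- The bijection `τ` maps the affine lines with direction in `A` onto affine lines with direction
in `B`. -/
def MapsLines (τ : E ≃ E) (A B : Set (ℙ F E)) : Prop :=
  ∀ P ∈ A, ∀ x, ∃ T ∈ B, ∀ y, τ y - τ x ∈ T.submodule ↔ y - x ∈ P.submodule

/-- Some plane meets `B` in two lines, with or without their point of intersection. -/
def HasLinePair (B : Set (ℙ F E)) : Prop :=
  ∃ e₁ e₂ f : E, Indep F e₁ e₂ f ∧ (∀ b : F, IsDir B (e₁ + b • f)) ∧
    (∀ a : F, IsDir B (e₂ + a • f)) ∧
    ∀ a b c : F, a ≠ 0 → b ≠ 0 → ¬ IsDir B (a • e₁ + b • e₂ + c • f)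

/-- The plane through `x` is ruled by its lines in the two directions, and surjectivity of `τ` makes
their images full lines. -/
theorem MapsLines.isGrid {τ : E ≃ E} {A B : Set (ℙ F E)} (hτ : MapsLines τ A B) {P Q : ℙ F E}
    (hP : P ∈ A) (hQ : Q ∈ A) (hPQ : P ≠ Q) {u w : E} (hu : u ≠ 0) (huP : u ∈ P.submodule)
    (hw : w ≠ 0) (hwQ : w ∈ Q.submodule) (x : E) :
    IsGrid B fun s t : F => τ (x + s • u + t • w) := by
  refine ⟨?_, ?_, ?_⟩
  · intro s t s' t' h
    have h := τ.injective h
    have h1 : (s - s') • u = (t' - t) • w := by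
      rw [← sub_eq_zero] at h ⊢
      rw [← h]; module
    have h2 : s - s' = 0 := by
      by_contra hne
      refine hPQ (point_eq_of_mem hu huP ?_)
      have := Submodule.smul_mem Q.submodule ((s - s')⁻¹ * (t' - t)) hwQ
      rwa [mul_smul, ← h1, smul_smul, inv_mul_cancel₀ hne, one_smul] at this
    rw [h2, zero_smul] at h1
    exact ⟨sub_eq_zero.1 h2, (sub_eq_zero.1 ((smul_eq_zero.1 h1.symm).resolve_right hw)).symm⟩
  · intro t
    obtain ⟨T, hT, h⟩ := hτ P hP (x + (0 : F) • u + t • w)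
    refine ⟨T, hT, fun y => ?_⟩
    obtain ⟨y, rfl⟩ := τ.surjective y
    rw [h, mem_submodule_iff_smul hu huP]
    refine exists_congr fun c => ?_
    rw [τ.injective.eq_iff, sub_eq_iff_eq_add', eq_comm]
    refine Eq.congr ?_ rfl
    module
  · intro s
    obtain ⟨T, hT, h⟩ := hτ Q hQ (x + s • u + (0 : F) • w)
    refine ⟨T, hT, fun y => ?_⟩
    obtain ⟨y, rfl⟩ := τ.surjective y
    rw [h, mem_submodule_iff_smul hw hwQ]
    refine exists_congr fun c => ?_
    rw [τ.injective.eq_iff, sub_eq_iff_eq_add', eq_comm]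
    refine Eq.congr ?_ rfl
    module

/-- Parallel lines in a plane spanned by two directions of `A` have parallel images. -/
theorem MapsLines.parallel_of_coplanar {τ : E ≃ E} {A B : Set (ℙ F E)} (hτ : MapsLines τ A B)
    (hτ' : MapsLines τ.symm B A) (hF : ∃ b : F, b ≠ 0 ∧ b ≠ 1) (hB : ¬ HasLinePair B)
    {P Q : ℙ F E} (hP : P ∈ A) (hQ : Q ∈ A) {x w : E} (hwQ : w ∈ Q.submodule)
    {T T' : ℙ F E}
    (hT : ∀ y, τ y - τ x ∈ T.submodule ↔ y - x ∈ P.submodule)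
    (hT' : ∀ y, τ y - τ (x + w) ∈ T'.submodule ↔ y - (x + w) ∈ P.submodule) : T = T' := by
  obtain ⟨u, hu, huP⟩ := exists_ne_zero_mem P
  by_cases hPQ : P = Q
  · subst hPQ
    have h1 := (hT (x + w + u)).2 (by
      rw [add_assoc, add_sub_cancel_left]; exact add_mem hwQ huP)
    have h2 := (hT (x + w)).2 (by rwa [add_sub_cancel_left])
    have h3 := (hT' (x + w + u)).2 (by rwa [add_sub_cancel_left])
    have h4 := sub_mem h1 h2
    rw [sub_sub_sub_cancel_right] at h4
    refine point_eq_of_mem ?_ h4 h3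
    rw [sub_ne_zero, τ.injective.ne_iff]
    simpa using hu
  by_cases hw : w = 0
  · subst hw
    have h1 := (hT (x + u)).2 (by rwa [add_sub_cancel_left])
    have h2 := (hT' (x + u)).2 (by rwa [add_zero, add_sub_cancel_left])
    rw [add_zero] at h2
    refine point_eq_of_mem ?_ h1 h2
    rw [sub_ne_zero, τ.injective.ne_iff]
    simpa using hu
  by_contra hne
  have hg := hτ.isGrid hP hQ hPQ hu huP hw hwQ x
  obtain ⟨z, e₁, e₂, f, hind, hl, hm, hz⟩ := hg.exists_paraboloid hF (t₀ := 1) hne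
    (fun y => by
      obtain ⟨y, rfl⟩ := τ.surjective y
      simp only [zero_smul, add_zero]
      rw [hT, mem_submodule_iff_smul hu huP]
      refine exists_congr fun c => ?_
      rw [τ.injective.eq_iff, sub_eq_iff_eq_add', eq_comm])
    (fun y => by
      obtain ⟨y, rfl⟩ := τ.surjective y
      simp only [zero_smul, add_zero, one_smul]
      rw [hT', mem_submodule_iff_smul hu huP]
      refine exists_congr fun c => ?_
      rw [τ.injective.eq_iff, sub_eq_iff_eq_add', eq_comm, add_right_comm])
  refine hB ⟨e₁, e₂, f, hind, hl, hm, ?_⟩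
  rintro p q r hp hq ⟨D, hDB, hD⟩
  obtain ⟨v, hv⟩ : ∃ v, v = p • e₁ + q • e₂ + r • f := ⟨_, rfl⟩
  rw [← hv] at hD
  have hv0 : v ≠ 0 := fun h => hp (hind p q r (by rw [← hv, h])).1
  -- Chosen so that the line through `z + b • e₂` with direction `v` meets the paraboloid again, at
  -- parameters `(p, b + q)`.
  obtain ⟨b, hb⟩ : ∃ b, b = (r - p * q) / p := ⟨_, rfl⟩
  have hpb : r = p * b + p * q := by rw [hb]; field_simp; ring
  obtain ⟨s, t, hst⟩ := (hz (z + b • e₂)).2 ⟨0, b, by module⟩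
  obtain ⟨s', t', hst'⟩ := (hz (z + b • e₂ + v)).2 ⟨p, b + q, by rw [hv, hpb]; module⟩
  obtain ⟨R, -, hR⟩ := hτ' D hDB (z + b • e₂)
  have h1 := (hR (z + b • e₂ + v)).2 (by rwa [add_sub_cancel_left])
  have h1ne : τ.symm (z + b • e₂ + v) - τ.symm (z + b • e₂) ≠ 0 := by
    rw [sub_ne_zero, τ.symm.injective.ne_iff]
    simpa using hv0
  obtain ⟨k, hk0, hk1⟩ := hF
  have h2 := (hR (z + b • e₂ + k • v)).2 (by
    rw [add_sub_cancel_left]; exact Submodule.smul_mem _ _ hD)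
  obtain ⟨c, hc⟩ := (mem_submodule_iff_smul h1ne h1).1 h2
  rw [τ.symm_apply_eq.2 hst.symm, τ.symm_apply_eq.2 hst'.symm, sub_eq_iff_eq_add] at hc
  -- The preimage of this line has two points in the plane of the grid, so it lies in that plane.
  -- The point at `k ≠ 0, 1` is thus a third point on the paraboloid, which its equation excludes.
  have h3 : τ (x + (c * (s' - s) + s) • u + (c * (t' - t) + t) • w) = z + b • e₂ + k • v := by
    rw [← τ.apply_symm_apply (z + b • e₂ + k • v), hc]
    congr 1
    module
  obtain ⟨a', b', hab⟩ := (hz _).1 ⟨_, _, h3⟩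
  obtain ⟨i1, i2, i3⟩ := hind (k * p - a') (b + k * q - b') (k * r - a' * b') (by
    rw [← sub_eq_zero] at hab
    rw [← hab, hv]; module)
  have ha' : a' = k * p := by linear_combination -i1
  have hb' : b' = b + k * q := by linear_combination -i2
  rw [ha', hb', hpb] at i3
  have : k * p * q * (1 - k) = 0 := by linear_combination i3
  have h1k : (1 : F) - k ≠ 0 := sub_ne_zero.2 hk1.symm
  exact (mul_ne_zero (mul_ne_zero (mul_ne_zero hk0 hp) hq) h1k) this

/-- If the directions in `A` span the space, then `τ` preserves parallelism. -/
theorem MapsLines.exists_map_points {τ : E ≃ E} {A B : Set (ℙ F E)} (hτ : MapsLines τ A B)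
    (hτ' : MapsLines τ.symm B A) (hF : ∃ b : F, b ≠ 0 ∧ b ≠ 1) (hB : ¬ HasLinePair B)
    (hA : (⨆ P ∈ A, P.submodule) = ⊤) {P : ℙ F E} (hP : P ∈ A) :
    ∃ T ∈ B, ∀ x y, τ y - τ x ∈ T.submodule ↔ y - x ∈ P.submodule := by
  choose T hTB hT using hτ P hP
  refine ⟨T 0, hTB 0, fun x y => ?_⟩
  suffices h : ∀ w x, T (x + w) = T x by
    rw [← h x 0, zero_add, hT]
  -- The translations that leave the image direction unchanged are closed under addition, so it
  -- suffices to treat those along points of `A`.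
  intro w
  have hw : w ∈ ⨆ P ∈ A, P.submodule := by rw [hA]; trivial
  induction hw using Submodule.iSup_induction' with
  | mem Q w hw =>
    intro x
    by_cases hQ : Q ∈ A
    · simp only [hQ, iSup_pos] at hw
      exact (hτ.parallel_of_coplanar hτ' hF hB hP hQ hw (hT _) (hT _)).symm
    · simp only [hQ, not_false_eq_true, iSup_neg, Submodule.mem_bot] at hw
      rw [hw, add_zero]
  | zero => intro x; rw [add_zero]
  | add v w _ _ hv hw => intro x; rw [← add_assoc, hw, hv]

end Parallelism

/-! ### Line pairs violate Property (*). -/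

section LinePair

variable {F : Type*} [Field F] {E : Type*} [AddCommGroup E] [Module F E]

theorem finrank_span_triple {u v w : E} (h : Indep F u v w) :
    Module.finrank F (Submodule.span F {u, v, w}) = 3 := by
  have hli : LinearIndependent F ![u, v, w] := by
    rw [Fintype.linearIndependent_iff]
    intro g hg
    rw [Fin.sum_univ_three] at hg
    obtain ⟨h0, h1, h2⟩ := h _ _ _ hg
    intro i
    fin_cases i <;> assumption
  have := finrank_span_eq_card hli
  rw [Matrix.range_cons, Matrix.range_cons, Matrix.range_cons, Matrix.range_empty,
    Set.union_empty, ← Set.insert_eq, ← Set.insert_eq] at this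
  simpa using this

theorem finrank_span_pair {u v : E} (h : ∀ a b : F, a • u + b • v = 0 → a = 0 ∧ b = 0) :
    Module.finrank F (Submodule.span F {u, v}) = 2 := by
  have := finrank_span_eq_card (LinearIndependent.pair_iff.2 h)
  rw [Matrix.range_cons, Matrix.range_cons, Matrix.range_empty, Set.union_empty,
    ← Set.insert_eq] at this
  simpa using this

/-- Only membership of the intersection point `f` is left open by a line pair; its two cases are the
two configurations that Property (*) excludes. -/
theorem HasLinePair.not_propertyStar {B : Set (ℙ F E)} (h : HasLinePair B) :
    ¬ PropertyStar B := by
  intro hstar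
  obtain ⟨e₁, e₂, f, hind, hl, hm, hno⟩ := h
  have hf0 : f ≠ 0 := by
    rintro rfl
    exact one_ne_zero (hind 0 0 1 (by simp)).2.2
  have dir_point : ∀ {P : ℙ F E} {v : E}, v ≠ 0 → v ∈ P.submodule → IsDir B v → P ∈ B := by
    rintro P v hv hvP ⟨T, hT, hvT⟩
    rwa [point_eq_of_mem hv hvP hvT]
  have le_iff : ∀ {P : ℙ F E} {v : E} {U : Submodule F E}, v ≠ 0 → v ∈ P.submodule →
      (P ∈ pts U ↔ v ∈ U) := by
    intro P v U hv hvP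
    rw [pts, Set.mem_ofPred_eq, submodule_eq_span hv hvP, Submodule.span_singleton_le_iff_mem]
  have hlB : ∀ P ∈ pts (Submodule.span F {e₁, f}), f ∉ P.submodule → P ∈ B := by
    intro P hP hfP
    obtain ⟨v, hv, hvP⟩ := exists_ne_zero_mem P
    obtain ⟨a, b, rfl⟩ := Submodule.mem_span_pair.1 ((le_iff hv hvP).1 hP)
    have ha : a ≠ 0 := by
      rintro rfl
      rw [zero_smul, zero_add] at hv hvP
      exact hfP ((Submodule.smul_mem_iff _ (left_ne_zero_of_smul hv)).1 hvP)
    have h2 := Submodule.smul_mem _ a⁻¹ hvP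
    rw [smul_add, smul_smul, smul_smul, inv_mul_cancel₀ ha, one_smul] at h2
    refine dir_point (fun h0 => ?_) h2 (hl _)
    exact one_ne_zero (hind 1 0 (a⁻¹ * b) (by rw [← h0]; module)).1
  have hmB : ∀ P ∈ pts (Submodule.span F {e₂, f}), f ∉ P.submodule → P ∈ B := by
    intro P hP hfP
    obtain ⟨v, hv, hvP⟩ := exists_ne_zero_mem P
    obtain ⟨a, b, rfl⟩ := Submodule.mem_span_pair.1 ((le_iff hv hvP).1 hP)
    have ha : a ≠ 0 := by
      rintro rfl
      rw [zero_smul, zero_add] at hv hvP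
      exact hfP ((Submodule.smul_mem_iff _ (left_ne_zero_of_smul hv)).1 hvP)
    have h2 := Submodule.smul_mem _ a⁻¹ hvP
    rw [smul_add, smul_smul, smul_smul, inv_mul_cancel₀ ha, one_smul] at h2
    refine dir_point (fun h0 => ?_) h2 (hm _)
    exact one_ne_zero (hind 0 1 (a⁻¹ * b) (by rw [← h0]; module)).2.1
  have hle : Submodule.span F {e₁, f} ≤ Submodule.span F {e₁, e₂, f} :=
    Submodule.span_mono (by grind)
  have hme : Submodule.span F {e₂, f} ≤ Submodule.span F {e₁, e₂, f} :=
    Submodule.span_mono (by grind)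
  have hsub : B ∩ pts (Submodule.span F {e₁, e₂, f}) ⊆
      pts (Submodule.span F {e₁, f}) ∪ pts (Submodule.span F {e₂, f}) := by
    rintro P ⟨hPB, hP⟩
    obtain ⟨v, hv, hvP⟩ := exists_ne_zero_mem P
    obtain ⟨a, b, c, rfl⟩ := Submodule.mem_span_triple.1 ((le_iff hv hvP).1 hP)
    by_cases ha : a = 0
    · exact Or.inr ((le_iff hv hvP).2 (Submodule.mem_span_pair.2 ⟨b, c, by rw [ha]; module⟩))
    by_cases hb : b = 0
    · exact Or.inl ((le_iff hv hvP).2 (Submodule.mem_span_pair.2 ⟨a, c, by rw [hb]; module⟩))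
    exact absurd ⟨P, hPB, hvP⟩ (hno a b c ha hb)
  have hinf : ∀ P, P ∈ pts (Submodule.span F {e₁, f} ⊓ Submodule.span F {e₂, f}) ↔
      f ∈ P.submodule := by
    intro P
    constructor
    · intro hP
      obtain ⟨v, hv, hvP⟩ := exists_ne_zero_mem P
      obtain ⟨h1, h2⟩ := Submodule.mem_inf.1 ((le_iff hv hvP).1 hP)
      obtain ⟨a, b, rfl⟩ := Submodule.mem_span_pair.1 h1
      obtain ⟨c, d, hcd⟩ := Submodule.mem_span_pair.1 h2
      have ha := (hind a (-c) (b - d) (by rw [← sub_eq_zero.2 hcd.symm]; module)).1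
      rw [ha, zero_smul, zero_add] at hv hvP
      exact (Submodule.smul_mem_iff _ (left_ne_zero_of_smul hv)).1 hvP
    · intro hP
      exact (le_iff hf0 hP).2 ⟨Submodule.subset_span (by simp), Submodule.subset_span (by simp)⟩
  obtain ⟨h1, h2⟩ := hstar (Submodule.span F {e₁, e₂, f}) (Submodule.span F {e₁, f})
    (Submodule.span F {e₂, f}) (finrank_span_triple hind)
    (finrank_span_pair fun a b hab => by
      obtain ⟨h1, -, h3⟩ := hind a 0 b (by rw [← hab]; module)
      exact ⟨h1, h3⟩)
    (finrank_span_pair fun a b hab => by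
      obtain ⟨-, h2, h3⟩ := hind 0 a b (by rw [← hab]; module)
      exact ⟨h2, h3⟩)
    hle hme (fun h => by
      have : e₁ ∈ Submodule.span F {e₂, f} := by
        rw [← h]; exact Submodule.subset_span (by simp)
      obtain ⟨a, b, hab⟩ := Submodule.mem_span_pair.1 this
      exact one_ne_zero (hind 1 (-a) (-b) (by rw [← hab]; module)).1)
  by_cases hfB : Projectivization.mk F f hf0 ∈ B
  · refine h1 (hsub.antisymm ?_)
    intro P hP
    refine ⟨?_, hP.elim (fun h => le_trans h hle) (fun h => le_trans h hme)⟩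
    by_cases hfP : f ∈ P.submodule
    · rwa [point_eq_of_mem hf0 hfP (mem_mk hf0)]
    · exact hP.elim (fun h => hlB P h hfP) (fun h => hmB P h hfP)
  · refine h2 (Set.Subset.antisymm ?_ ?_)
    · intro P hP
      refine ⟨hsub hP, fun h => hfB ?_⟩
      rw [← point_eq_of_mem hf0 ((hinf P).1 h) (mem_mk hf0)]
      exact hP.1
    · rintro P ⟨hP, hPf⟩
      rw [hinf] at hPf
      exact ⟨hP.elim (fun h => hlB P h hPf) (fun h => hmB P h hPf),
        hP.elim (fun h => le_trans h hle) (fun h => le_trans h hme)⟩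

end LinePair

/-! ### Frames and bases. -/

section Frames

variable {F : Type*} [Field F] {E : Type*} [AddCommGroup E] [Module F E]

/-- A frame has one point to spare, so a spanning set can avoid a prescribed point. -/
theorem IsFrame.exists_spanning_subset {A : Set (ℙ F E)} (hA : IsFrame A) (P : ℙ F E) :
    ∃ C ⊆ A, P ∉ C ∧ C.ncard = Module.finrank F E ∧ (⨆ Q ∈ C, Q.submodule) = ⊤ := by
  obtain ⟨hfin, hcard, hspan⟩ := hA
  have h1 : Module.finrank F E ≤ (A \ {P}).ncard := by
    have := Set.pred_ncard_le_ncard_sdiff_singleton A P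
    omega
  obtain ⟨C, hC, hCc⟩ := Set.exists_subset_card_eq h1
  have hCA : C ⊆ A := hC.trans Set.sdiff_subset
  exact ⟨C, hCA, fun h => (hC h).2 rfl, hCc, hspan C hCA hCc⟩

/-- The points of a frame are, with respect to a suitable basis, the points of the basis vectors
and the point of their sum. -/
theorem IsFrame.exists_basis {A : Set (ℙ F E)} (hA : IsFrame A) :
    ∃ b : Module.Basis (Fin (Module.finrank F E)) F E,
      (∀ i, ∃ P ∈ A, b i ∈ P.submodule) ∧ ∃ P ∈ A, ∑ i, b i ∈ P.submodule := by
  have hne : A.Nonempty := by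
    apply Set.nonempty_of_ncard_ne_zero
    rw [hA.2.1]; omega
  obtain ⟨P₀, hP₀⟩ := hne
  obtain ⟨C, hCA, hPC, hCcard, hCspan⟩ := hA.exists_spanning_subset P₀
  have hCfin : C.Finite := hA.1.subset hCA
  have : Finite C := hCfin
  let e : C ≃ Fin (Module.finrank F E) := Finite.equivFinOfCardEq hCcard
  let v : Fin (Module.finrank F E) → E := fun i => (e.symm i).1.rep
  have hvP : ∀ i, v i ∈ (e.symm i).1.submodule := fun i => by
    rw [Projectivization.submodule_eq]; exact Submodule.mem_span_singleton_self _
  have hv : ⊤ ≤ Submodule.span F (Set.range v) := by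
    rw [← hCspan]
    refine iSup₂_le fun Q hQ => ?_
    rw [Projectivization.submodule_eq, Submodule.span_singleton_le_iff_mem]
    refine Submodule.subset_span ⟨e ⟨Q, hQ⟩, ?_⟩
    simp [v]
  let c := basisOfTopLeSpanOfCardEqFinrank v hv (by simp)
  have hc : ∀ i, c i = v i := fun i => by simp [c]
  -- Exchanging `P₀` for the `i`-th point still spans, which fails if `P₀` lies in the `i`-th
  -- coordinate hyperplane. The coordinates of `P₀` then serve as scaling factors.
  have hx : ∀ i, c.repr P₀.rep i ≠ 0 := by
    intro i hi
    obtain ⟨Q, hQ⟩ : ∃ Q, Q = e.symm i := ⟨_, rfl⟩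
    have hD : (insert P₀ (C \ {Q.1})).ncard = Module.finrank F E := by
      rw [Set.ncard_insert_of_notMem (fun h => hPC h.1) (hCfin.subset Set.sdiff_subset),
        Set.ncard_sdiff_singleton_add_one Q.2 hCfin, hCcard]
    have htop := hA.2.2 _ (Set.insert_subset hP₀ (Set.sdiff_subset.trans hCA)) hD
    have hle : (⨆ P ∈ insert P₀ (C \ {Q.1}), P.submodule) ≤ LinearMap.ker (c.coord i) := by
      refine iSup₂_le fun P hP => ?_
      rw [Projectivization.submodule_eq, Submodule.span_singleton_le_iff_mem,
        LinearMap.mem_ker, Module.Basis.coord_apply]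
      rcases hP with rfl | ⟨hPC, hPQ⟩
      · exact hi
      · have : P.rep = c (e ⟨P, hPC⟩) := by rw [hc]; simp [v]
        rw [this, Module.Basis.repr_self, Finsupp.single_eq_of_ne]
        intro h
        apply hPQ
        rw [hQ, h]; simp
    rw [htop, top_le_iff] at hle
    have : c i ∈ LinearMap.ker (c.coord i) := by rw [hle]; trivial
    simp at this
  refine ⟨c.isUnitSMul (fun i => (hx i).isUnit), fun i => ⟨_, hCA (e.symm i).2, ?_⟩, P₀, hP₀, ?_⟩
  · rw [Module.Basis.isUnitSMul_apply, hc]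
    exact Submodule.smul_mem _ _ (hvP i)
  · simp only [Module.Basis.isUnitSMul_apply]
    rw [c.sum_repr, Projectivization.submodule_eq]
    exact Submodule.mem_span_singleton_self _

end Frames

/-! ### Rational points over subfields. -/

section Subgeometries

variable {F : Type*} [Field F] {E : Type*} [AddCommGroup E] [Module F E]

theorem exists_smul_repr_mem {F₀ : Subfield F}
    {b : Module.Basis (Fin (Module.finrank F E)) F E} {P : ℙ F E} (hP : P ∈ subfieldPoints F₀ b)
    {v : E} (hv : v ≠ 0) (hvP : v ∈ P.submodule) :
    ∃ l : F, l ≠ 0 ∧ ∀ i, b.repr (l • v) i ∈ F₀ := by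
  obtain ⟨w, hw, hwP, h⟩ := hP
  obtain ⟨l, rfl⟩ := (mem_submodule_iff_smul hv hvP).1 hwP
  exact ⟨l, left_ne_zero_of_smul hw, h⟩

/-- A proper subgeometry contains no line of the ambient space minus a point. -/
theorem subfieldPoints_eq_univ_of_line (hF : ∃ b : F, b ≠ 0 ∧ b ≠ 1) {F₀ : Subfield F}
    {c : Module.Basis (Fin (Module.finrank F E)) F E} {e f : E}
    (hind : ∀ x y : F, x • e + y • f = 0 → x = 0 ∧ y = 0)
    (h : ∀ b : F, IsDir (subfieldPoints F₀ c) (e + b • f)) : subfieldPoints F₀ c = Set.univ := by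
  suffices hF₀ : ∀ y, y ∈ F₀ by
    ext P
    obtain ⟨v, hv, hvP⟩ := exists_ne_zero_mem P
    exact ⟨fun _ => trivial, fun _ => ⟨v, hv, hvP, fun i => hF₀ _⟩⟩
  have hrat : ∀ b : F, ∃ l : F, l ≠ 0 ∧ ∀ i, l * (c.repr e i + b * c.repr f i) ∈ F₀ := by
    intro b
    obtain ⟨P, hP, hbP⟩ := h b
    obtain ⟨l, hl, hl'⟩ := exists_smul_repr_mem hP (fun h0 => one_ne_zero
      (hind 1 b (by rw [one_smul, h0])).1) hbP
    exact ⟨l, hl, fun i => by simpa [mul_add] using hl' i⟩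
  have he : e ≠ 0 := fun h0 => one_ne_zero (hind 1 0 (by simp [h0])).1
  obtain ⟨i, hi⟩ : ∃ i, c.repr e i ≠ 0 := by
    by_contra! hcon
    exact he (c.repr.map_eq_zero_iff.1 (Finsupp.ext hcon))
  obtain ⟨l₀, hl₀, hl₀e⟩ := hrat 0
  simp only [zero_mul, add_zero] at hl₀e
  obtain ⟨k, hk⟩ : ∃ k, k = c.repr f i / c.repr e i := ⟨_, rfl⟩
  have hfi : c.repr f i = k * c.repr e i := by rw [hk]; field_simp
  obtain ⟨j, hj⟩ : ∃ j, c.repr f j - k * c.repr e j ≠ 0 := by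
    by_contra! hcon
    have : f - k • e = 0 := c.repr.map_eq_zero_iff.1 (Finsupp.ext (by simpa using hcon))
    exact one_ne_zero (hind (-k) 1 (by rw [← this]; module)).2
  obtain ⟨m, hm⟩ : ∃ m, m = l₀ * (c.repr f j - k * c.repr e j) := ⟨_, rfl⟩
  have hm0 : m ≠ 0 := hm ▸ mul_ne_zero hl₀ hj
  -- With `z = y / m`, the given direction with parameter `z / (1 - z * k)` is that of `e + z • (f -
  -- k • e)`. Its `i`-th coordinate is that of `e`, which fixes the scaling up to `F₀`; the `j`-th
  -- coordinate then yields `y`.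
  have hbig : ∀ y, k * y ≠ m → y ∈ F₀ := by
    intro y hy
    have hy' : 1 - y / m * k ≠ 0 := by
      intro h0
      apply hy
      field_simp at h0
      linear_combination -h0
    obtain ⟨l, hl, hle⟩ := hrat (y / m / (1 - y / m * k))
    have h1 := hle i
    have h2 := hle j
    rw [hfi] at h1
    have h3 : l / (1 - y / m * k) / l₀ ∈ F₀ := by
      have := div_mem h1 (hl₀e i)
      convert this using 1
      generalize y / m = z at *
      field_simp
      ring
    have h4 := sub_mem (div_mem h2 h3) (hl₀e j)
    convert h4 using 1
    obtain ⟨z, hz⟩ : ∃ z, z = y / m := ⟨_, rfl⟩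
    have hyz : y = z * m := by rw [hz]; field_simp
    rw [← hz] at hy' ⊢
    rw [hyz, hm]
    field_simp
    ring
  intro y
  by_cases hy : k * y = m
  -- The single exceptional `y` is the sum of the two unexceptional elements `z * y` and `y - z *
  -- y`.
  · obtain ⟨z, hz0, hz1⟩ := hF
    have hk0 : k ≠ 0 := by rintro rfl; exact hm0 (by rw [← hy, zero_mul])
    have hy0 : y ≠ 0 := by rintro rfl; exact hm0 (by rw [← hy, mul_zero])
    have h1 := hbig (z * y) (fun h => hz1 (by
      rw [← hy] at h
      have := mul_left_cancel₀ hk0 h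
      exact mul_right_cancel₀ hy0 (this.trans (one_mul y).symm)))
    have h2 := hbig (y - z * y) (fun h => by
      rw [← hy] at h
      have := mul_left_cancel₀ hk0 h
      exact mul_ne_zero hz0 hy0 (by linear_combination -this))
    have := add_mem h2 h1
    rwa [sub_add_cancel] at this
  · exact hbig y hy

/-- If `d` is a basis of vectors that are rational with respect to `b`, then both bases have
the same rational vectors. -/
theorem repr_mem_iff {ι : Type*} [Finite ι] {R : Subfield F} {b d : Module.Basis ι F E}
    (h : ∀ i j, b.repr (d i) j ∈ R) (v : E) :
    (∀ i, b.repr v i ∈ R) ↔ ∀ i, d.repr v i ∈ R := by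
  have := Fintype.ofFinite ι
  have key : ∀ (b : Module.Basis ι F E) (v : E),
      (∀ i, b.repr v i ∈ R) ↔ v ∈ Submodule.span R (Set.range b) := by
    intro b v
    rw [Module.Basis.mem_span_iff_repr_mem]
    refine forall_congr' fun i => ?_
    constructor
    · exact fun h => ⟨⟨_, h⟩, rfl⟩
    · rintro ⟨r, hr⟩
      rw [← hr]; exact r.2
  have hli : ∀ b : Module.Basis ι F E, LinearIndependent R b := fun b =>
    b.linearIndependent.restrict_scalars' R
  rw [key, key]
  have hle : Submodule.span R (Set.range d) ≤ Submodule.span R (Set.range b) := by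
    rw [Submodule.span_le]
    rintro _ ⟨i, rfl⟩
    exact (key b _).1 (h i)
  have : FiniteDimensional R (Submodule.span R (Set.range b)) :=
    FiniteDimensional.span_of_finite R (Set.finite_range b)
  -- Both bases stay independent over `R`, so the nested `R`-spans have equal dimension.
  rw [Submodule.eq_of_le_of_finrank_eq hle
    (by rw [finrank_span_eq_card (hli d), finrank_span_eq_card (hli b)])]

theorem repr_isUnitSMul_eq {ι : Type*} (b : Module.Basis ι F E) {w : ι → F}
    (hw : ∀ i, IsUnit (w i)) (v : E) (i : ι) :
    (b.isUnitSMul hw).repr v i = (w i)⁻¹ * b.repr v i := by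
  rw [Module.Basis.repr_isUnitSMul, Units.smul_def, smul_eq_mul, Units.val_inv_eq_inv_val,
    IsUnit.unit_spec]

/-- Comparison of coordinates for nested subgeometries. -/
theorem subfieldPoints_subset {F₀ R : Subfield F}
    {c b : Module.Basis (Fin (Module.finrank F E)) F E} (hd : 2 ≤ Module.finrank F E)
    (h : subfieldPoints F₀ c ⊆ subfieldPoints R b) :
    F₀ ≤ R ∧ ∃ l : F, l ≠ 0 ∧ ∀ i j, b.repr (l • c i) j ∈ R := by
  have hmem : ∀ v : E, v ≠ 0 → (∀ i, c.repr v i ∈ F₀) →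
      ∃ l : F, l ≠ 0 ∧ ∀ i, b.repr (l • v) i ∈ R := by
    intro v hv hvc
    exact exists_smul_repr_mem (h ⟨v, hv, mem_mk hv, hvc⟩) hv (mem_mk hv)
  have hsingle : ∀ i j, c.repr (c i) j ∈ F₀ := by
    intro i j
    rw [Module.Basis.repr_self, Finsupp.single_apply]
    split_ifs
    · exact one_mem _
    · exact zero_mem _
  choose l hl hlc using fun i => hmem (c i) (c.ne_zero i) (hsingle i)
  have i₀ : Fin (Module.finrank F E) := ⟨0, by omega⟩
  have hsum : ∀ i, c.repr (∑ j, c j) i = 1 := by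
    intro i
    rw [map_sum, Finsupp.finsetSum_apply]
    simp [Finsupp.single_apply]
  obtain ⟨m, hm, hms⟩ := hmem (∑ j, c j)
    (fun h0 => by have := hsum i₀; rw [h0] at this; simp at this)
    (fun i => by rw [hsum]; exact one_mem _)
  have hml := (repr_mem_iff (d := c.isUnitSMul fun i => (hl i).isUnit)
    (by intro i j; rw [Module.Basis.isUnitSMul_apply]; exact hlc i j) _).1 hms
  -- The sum of the basis vectors ties the separate scalars `l i` together, so the single scalar `m`
  -- serves all of them.
  have hml' : ∀ i, m / l i ∈ R := by
    intro i
    have := hml i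
    rw [repr_isUnitSMul_eq, map_smul, Finsupp.smul_apply, hsum] at this
    simpa [div_eq_mul_inv, mul_comm] using this
  have hmc : ∀ i j, b.repr (m • c i) j ∈ R := by
    intro i j
    have := mul_mem (hml' i) (hlc i j)
    rw [map_smul, Finsupp.smul_apply, smul_eq_mul] at this ⊢
    convert this using 1
    have := hl i
    field_simp
  refine ⟨?_, m, hm, hmc⟩
  intro a ha
  obtain ⟨i₁, i₂, hi⟩ : ∃ i₁ i₂ : Fin (Module.finrank F E), i₁ ≠ i₂ :=
    ⟨⟨0, by omega⟩, ⟨1, by omega⟩, by simp⟩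
  have hr1 : c.repr (c i₁ + a • c i₂) i₁ = 1 := by simp [hi.symm]
  have hr2 : c.repr (c i₁ + a • c i₂) i₂ = a := by simp [hi]
  obtain ⟨k, hk, hkb⟩ := hmem (c i₁ + a • c i₂)
    (fun h0 => by rw [h0] at hr1; simp at hr1) (by
      intro i
      rw [map_add, map_smul, Finsupp.add_apply, Finsupp.smul_apply]
      exact add_mem (hsingle _ _) (mul_mem ha (hsingle _ _)))
  have hmr := (repr_mem_iff (d := c.isUnitSMul fun i => hm.isUnit)
    (by intro i j; rw [Module.Basis.isUnitSMul_apply]; exact hmc i j) _).1 hkb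
  have hmr' : ∀ i, m⁻¹ * (k * c.repr (c i₁ + a • c i₂) i) ∈ R := by
    intro i
    have := hmr i
    rwa [repr_isUnitSMul_eq, map_smul, Finsupp.smul_apply, smul_eq_mul] at this
  have h1 := hmr' i₁
  have h2 := hmr' i₂
  rw [hr1] at h1
  rw [hr2] at h2
  have := div_mem h2 h1
  convert this using 1
  field_simp

end Subgeometries

/-! ### From parallelism to additivity. -/

section Additivity

variable {F : Type*} [Field F] {E : Type*} [AddCommGroup E] [Module F E]

/-- A parallelism-preserving bijection is additive up to a translation. -/
theorem map_add_sub_of_parallel {τ : E ≃ E} {K K' : Set (ℙ F E)}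
    (hspan : ∀ P : ℙ F E, ∃ C ⊆ K, P ∉ C ∧ (⨆ Q ∈ C, Q.submodule) = ⊤)
    (hK : ∀ P ∈ K, ∃ T ∈ K', ∀ x y, τ y - τ x ∈ T.submodule ↔ y - x ∈ P.submodule) (x v : E) :
    τ (x + v) - τ x = τ v - τ 0 := by
  have hstep : ∀ P ∈ K, ∀ Q ∈ K, P ≠ Q → ∀ v ∈ P.submodule, ∀ w ∈ Q.submodule, ∀ x,
      τ (x + w + v) - τ (x + w) = τ (x + v) - τ x := by
    intro P hP Q hQ hPQ v hv w hw x
    obtain ⟨T, -, hT⟩ := hK P hP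
    obtain ⟨U, -, hU⟩ := hK Q hQ
    by_contra hne
    rw [← sub_eq_zero] at hne
    -- The defect of the image parallelogram is a difference of opposite sides in two ways, so it
    -- lies in both `T` and `U`.
    have h1 := sub_mem ((hT (x + w) (x + w + v)).2 (by rwa [add_sub_cancel_left]))
      ((hT x (x + v)).2 (by rwa [add_sub_cancel_left]))
    have h2 := sub_mem ((hU (x + v) (x + w + v)).2 (by rwa [add_right_comm, add_sub_cancel_left]))
      ((hU x (x + w)).2 (by rwa [add_sub_cancel_left]))
    have hTU : T = U := point_eq_of_mem hne h1 (by convert h2 using 1; abel)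
    subst hTU
    obtain ⟨u, hu, huP⟩ := exists_ne_zero_mem P
    have := (hU 0 u).1 ((hT 0 u).2 (by rwa [sub_zero]))
    rw [sub_zero] at this
    exact hPQ (point_eq_of_mem hu huP this)
  have hconst : ∀ P ∈ K, ∀ v ∈ P.submodule, ∀ w x,
      τ (x + w + v) - τ (x + w) = τ (x + v) - τ x := by
    intro P hP v hv w
    -- `C` avoids `P`, so even a shift along `P` itself decomposes into shifts in other directions.
    obtain ⟨C, hCK, hPC, hC⟩ := hspan P
    have hw : w ∈ ⨆ Q ∈ C, Q.submodule := by rw [hC]; trivial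
    induction hw using Submodule.iSup_induction' with
    | mem Q w hw =>
      intro x
      by_cases hQ : Q ∈ C
      · simp only [hQ, iSup_pos] at hw
        exact hstep P hP Q (hCK hQ) (fun h => hPC (h ▸ hQ)) v hv w hw x
      · simp only [hQ, not_false_eq_true, iSup_neg, Submodule.mem_bot] at hw
        rw [hw, add_zero]
    | zero => intro x; rw [add_zero]
    | add w w' _ _ hw hw' => intro x; rw [← add_assoc, hw', hw]
  obtain ⟨P₀, -⟩ | hempty := (Set.univ : Set (ℙ F E)).eq_empty_or_nonempty.symm
  · obtain ⟨C, hCK, -, hC⟩ := hspan P₀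
    have hv : v ∈ ⨆ Q ∈ C, Q.submodule := by rw [hC]; trivial
    induction hv using Submodule.iSup_induction' generalizing x with
    | mem Q v hv =>
      by_cases hQ : Q ∈ C
      · simp only [hQ, iSup_pos] at hv
        have := hconst Q (hCK hQ) v hv x 0
        rwa [zero_add, zero_add] at this
      · simp only [hQ, not_false_eq_true, iSup_neg, Submodule.mem_bot] at hv
        rw [hv, add_zero, sub_self, sub_self]
    | zero => rw [add_zero, sub_self, sub_self]
    | add v w _ _ hv hw =>
      have h1 := hw (x + v)
      have h2 := hw v
      have h3 := hv x
      rw [← add_assoc, ← sub_add_sub_cancel _ (τ (x + v)), h1, h3, ← h2]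
      abel
  · have : ∀ v : E, v = 0 := by
      intro v
      by_contra hv
      exact (Set.eq_empty_iff_forall_notMem.1 hempty) (Projectivization.mk F v hv) trivial
    rw [this v, add_zero, sub_self, sub_self]

end Additivity

/-! ### Additive maps and closures. -/

section Subgeometry

variable {F : Type*} [Field F] {E : Type*} [AddCommGroup E] [Module F E]

/-- Although `t` is only additive, it sends each coordinate axis into a line, so surjectivity makes
the images span; their number does the rest. -/
theorem exists_basis_map {ι : Type*} [Fintype ι] (b : Module.Basis ι F E) (t : E ≃+ E)
    (h : ∀ i, ∀ a : F, ∃ k : F, t (a • b i) = k • t (b i)) :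
    ∃ b' : Module.Basis ι F E, ∀ i, b' i = t (b i) := by
  have hspan : ⊤ ≤ Submodule.span F (Set.range fun i => t (b i)) := by
    intro w _
    obtain ⟨u, rfl⟩ := t.surjective w
    rw [← b.sum_repr u, map_sum]
    refine sum_mem fun i _ => ?_
    obtain ⟨k, hk⟩ := h i (b.repr u i)
    rw [hk]
    exact Submodule.smul_mem _ _ (Submodule.subset_span ⟨i, rfl⟩)
  exact ⟨basisOfTopLeSpanOfCardEqFinrank _ hspan (Module.finrank_eq_card_basis b).symm,
    fun i => by simp⟩

/-- An additive bijection inducing a bijection from `K` onto `K'` also maps the closure of `K` onto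
the closure of `K'`. -/
theorem exists_preimage_of_isClosure {t : E ≃+ E} {K K' S S' : Set (ℙ F E)}
    (hd : 2 ≤ Module.finrank F E) (hS : IsClosure K S) (hS' : IsClosure K' S')
    (hK : ∀ P ∈ K, ∃ T ∈ K', ∀ v, t v ∈ T.submodule ↔ v ∈ P.submodule)
    (hK' : ∀ T ∈ K', ∃ P ∈ K, ∀ v, t v ∈ T.submodule ↔ v ∈ P.submodule) :
    ∀ T ∈ S', ∃ P ∈ S, ∀ v, t v ∈ T.submodule ↔ v ∈ P.submodule := by
  obtain ⟨⟨A, hAK, hA⟩, ⟨⟨F₀, c, rfl⟩, hKS⟩, hleast⟩ := hS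
  obtain ⟨b, hbA, P₀, hP₀, hbP₀⟩ := hA.exists_basis
  have i₀ : Fin (Module.finrank F E) := ⟨0, by omega⟩
  have hline : ∀ P ∈ K, ∀ v ∈ P.submodule, v ≠ 0 → ∀ a : F, ∃ k : F, t (a • v) = k • t v := by
    intro P hP v hv hv0 a
    obtain ⟨T, -, hT⟩ := hK P hP
    exact (mem_submodule_iff_smul (t.map_ne_zero_iff.2 hv0) ((hT v).2 hv)).1
      ((hT _).2 (Submodule.smul_mem _ _ hv))
  have hfb : ∀ i, ∀ a : F, ∃ k : F, t (a • b i) = k • t (b i) := by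
    intro i a
    obtain ⟨P, hP, hbP⟩ := hbA i
    exact hline P (hAK hP) _ hbP (b.ne_zero i) a
  obtain ⟨b', hb'⟩ := exists_basis_map b t hfb
  have hsum0 : ∑ i, b i ≠ 0 := by
    intro h0
    have := congrArg (fun w => b.repr w i₀) h0
    simp [Finsupp.single_apply] at this
  choose g hg using hline P₀ (hAK hP₀) _ hbP₀ hsum0
  -- The frame point `∑ i, b i` forces the same scalar function on every axis.
  have hgb : ∀ i, ∀ a : F, t (a • b i) = g a • b' i := by
    choose f hf using hfb
    intro i a
    have h1 : ∑ i, t (a • b i) = ∑ i, g a • t (b i) := by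
      rw [← Finset.smul_sum, ← map_sum t, ← map_sum t, ← Finset.smul_sum, hg]
    have h2 := congrArg (fun w => b'.repr w i) h1
    simp only [hf, ← hb', map_sum, map_smul, Module.Basis.repr_self, Finsupp.finsetSum_apply,
      Finsupp.smul_apply, Finsupp.single_apply, smul_eq_mul, mul_ite, mul_one, mul_zero,
      Finset.sum_ite_eq', Finset.mem_univ, if_true] at h2
    rw [hf, hb', h2]
  have hrepr : ∀ v i, b'.repr (t v) i = g (b.repr v i) := by
    intro v i
    conv_lhs => rw [← b.sum_repr v, map_sum]
    simp only [hgb, map_sum, map_smul, Module.Basis.repr_self, Finsupp.finsetSum_apply,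
      Finsupp.smul_apply, Finsupp.single_apply, smul_eq_mul, mul_ite, mul_one, mul_zero,
      Finset.sum_ite_eq', Finset.mem_univ, if_true]
  have hginj : ∀ a a', g a = g a' → a = a' := by
    intro a a' h
    have h1 : t (a • b i₀) = t (a' • b i₀) := by rw [hgb, hgb, h]
    have h2 := congrArg (fun w => b.repr w i₀) (t.injective h1)
    simpa using h2
  have hgsurj : ∀ k, ∃ a, g a = k := by
    intro k
    obtain ⟨v, hv⟩ := t.surjective (k • b' i₀)
    refine ⟨b.repr v i₀, ?_⟩
    rw [← hrepr, hv]
    simp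
  have hg1 : g 1 = 1 := by
    have := hrepr (b i₀) i₀
    rw [← hb'] at this
    simpa using this.symm
  have hgadd : ∀ a a', g (a + a') = g a + g a' := by
    intro a a'
    have h1 := hrepr (a • b i₀ + a' • b i₀) i₀
    rw [map_add, hgb, hgb] at h1
    simpa using h1.symm
  have hg0 : g 0 = 0 := by simpa using hgadd 0 0
  have hgneg : ∀ a, g (-a) = - g a := by
    intro a
    have := hgadd a (-a)
    rw [add_neg_cancel, hg0] at this
    exact eq_neg_of_add_eq_zero_right this.symm
  let R : Subfield F :=
    { carrier := {r | ∀ a, g (a * r) = g a * g r}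
      mul_mem' := by
        intro r s hr hs a
        rw [← mul_assoc, hs, hr, hs, mul_assoc]
      one_mem' := by intro a; rw [hg1, mul_one, mul_one]
      add_mem' := by
        intro r s hr hs a
        rw [mul_add, hgadd, hr, hs, hgadd, mul_add]
      zero_mem' := by intro a; rw [hg0, mul_zero, mul_zero, hg0]
      neg_mem' := by
        intro r hr a
        rw [mul_neg, hgneg, hr, hgneg, mul_neg]
      inv_mem' := by
        intro r hr a
        by_cases h0 : r = 0
        · rw [h0, inv_zero, hg0, mul_zero, mul_zero, hg0]
        have hgr : g r ≠ 0 := fun h => h0 (hginj _ _ (h.trans hg0.symm))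
        have h1 := hr (a * r⁻¹)
        have h2 := hr r⁻¹
        rw [inv_mul_cancel_right₀ h0] at h1
        rw [inv_mul_cancel₀ h0, hg1] at h2
        apply mul_right_cancel₀ hgr
        rw [← h1, mul_assoc, ← h2, mul_one] }
  have hR : ∀ r ∈ R, ∀ a, g (a * r) = g a * g r := fun r hr => hr
  have hrat : ∀ v, (∀ i, b.repr v i ∈ R) → ∀ a : F, t (a • v) = g a • t v := by
    intro v hv a
    apply b'.repr.injective
    ext i
    rw [hrepr, map_smul b.repr, map_smul b'.repr, Finsupp.smul_apply, Finsupp.smul_apply, hrepr,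
      smul_eq_mul, smul_eq_mul, hR _ (hv i)]
  -- Scale a vector of the point to have `j`-th coordinate `1`. Then `t (a • w) = k • t w` forces `k
  -- = g a`, and the other coordinates say exactly that they lie in `R`.
  have hKR : K ⊆ subfieldPoints R b := by
    intro P hP
    obtain ⟨v, hv, hvP⟩ := exists_ne_zero_mem P
    obtain ⟨j, hj⟩ : ∃ j, b.repr v j ≠ 0 := by
      by_contra! hcon
      exact hv (b.repr.map_eq_zero_iff.1 (Finsupp.ext hcon))
    have hv' := smul_ne_zero (inv_ne_zero hj) hv
    have hvP' := Submodule.smul_mem _ (b.repr v j)⁻¹ hvP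
    have hj' : b.repr ((b.repr v j)⁻¹ • v) j = 1 := by simp [hj]
    generalize (b.repr v j)⁻¹ • v = w at hv' hvP' hj'
    refine ⟨w, hv', hvP', fun i a => ?_⟩
    obtain ⟨k, hk⟩ := hline P hP w hvP' hv' a
    have h1 := hrepr (a • w) j
    have h2 := hrepr (a • w) i
    rw [hk, map_smul, map_smul, Finsupp.smul_apply, Finsupp.smul_apply, hrepr] at h1 h2
    rw [hj', hg1, smul_eq_mul, smul_eq_mul, mul_one, mul_one] at h1
    rw [smul_eq_mul, smul_eq_mul, h1] at h2
    exact h2.symm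
  -- Minimality of the closure puts it inside the `R`-rational points, where `t` is semilinear with
  -- respect to `g`.
  obtain ⟨hF₀, l, hl, hlc⟩ := subfieldPoints_subset hd (hleast ⟨⟨R, b, rfl⟩, hKR⟩)
  have hratc : ∀ v, (∀ i, c.repr v i ∈ F₀) → ∀ i, b.repr (l • v) i ∈ R := by
    intro v hv i
    rw [← c.sum_repr v, Finset.smul_sum, map_sum, Finsupp.finsetSum_apply]
    refine sum_mem fun j _ => ?_
    rw [smul_comm, map_smul, Finsupp.smul_apply]
    exact mul_mem (hF₀ (hv j)) (hlc j i)
  obtain ⟨c', hc'⟩ := exists_basis_map (c.isUnitSMul fun _ => hl.isUnit) t (by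
    intro i a
    rw [Module.Basis.isUnitSMul_apply]
    exact ⟨g a, hrat _ (hlc i) a⟩)
  have htc : ∀ v, t (l • v) = ∑ i, g (c.repr v i) • c' i := by
    intro v
    conv_lhs => rw [← c.sum_repr v, Finset.smul_sum, map_sum]
    refine Finset.sum_congr rfl fun i _ => ?_
    rw [smul_comm, hrat _ (hlc i), hc', Module.Basis.isUnitSMul_apply]
  let ρ : R →+* F :=
    { toFun := fun r => g r
      map_one' := hg1
      map_mul' := fun r s => hR _ s.2 _
      map_zero' := hg0
      map_add' := fun r s => hgadd _ _ }
  -- The image of the closure of `K` is the subgeometry over `g(F₀)` with basis `t (l • c i)`. It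
  -- contains `K'`, hence its closure.
  have hX : S' ⊆ subfieldPoints ((F₀.comap R.subtype).map ρ) c' := by
    refine hS'.2.2 ⟨⟨_, c', rfl⟩, ?_⟩
    intro T hT
    obtain ⟨P, hP, hPT⟩ := hK' T hT
    obtain ⟨v, hv, hvP, hvc⟩ := hKS hP
    refine ⟨t (l • v), t.map_ne_zero_iff.2 (smul_ne_zero hl hv),
      (hPT _).2 (Submodule.smul_mem _ _ hvP), fun i => ?_⟩
    rw [htc, c'.repr_sum_self]
    exact ⟨⟨c.repr v i, hF₀ (hvc i)⟩, hvc i, rfl⟩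
  intro T hT
  obtain ⟨w, hw, hwT, hwc⟩ := hX hT
  choose a haF hag using hwc
  have hac : ∀ i, c.repr (∑ i, (a i : F) • c i) i = a i := fun i => by rw [c.repr_sum_self]
  have hw' : w = t (l • ∑ i, (a i : F) • c i) := by
    rw [htc, ← c'.sum_repr w]
    refine Finset.sum_congr rfl fun i _ => ?_
    rw [hac, ← hag]; rfl
  have hr := hratc (∑ i, (a i : F) • c i) (fun i => by rw [hac]; exact haF i)
  obtain ⟨v, hv⟩ : ∃ v, v = ∑ i, (a i : F) • c i := ⟨_, rfl⟩
  rw [← hv] at hw' hr hac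
  have hlv : l • v ≠ 0 := by
    rintro h0
    rw [h0, map_zero] at hw'
    exact hw hw'
  have hv0 : v ≠ 0 := by rintro rfl; exact hlv (smul_zero _)
  refine ⟨Projectivization.mk F v hv0, ⟨v, hv0, mem_mk hv0, fun i => ?_⟩, fun u => ?_⟩
  · rw [hac]; exact haF i
  · rw [mem_submodule_iff_smul hw hwT,
      mem_submodule_iff_smul hlv (Submodule.smul_mem _ _ (mem_mk hv0)), hw']
    constructor
    · rintro ⟨k, hk⟩
      obtain ⟨a, rfl⟩ := hgsurj k
      rw [← hrat _ hr] at hk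
      exact ⟨a, t.injective hk⟩
    · rintro ⟨a, rfl⟩
      exact ⟨g a, hrat _ hr a⟩

end Subgeometry

/-! ### Collinearity at infinity. -/

section Collinearity

variable {F : Type*} [Field F] {E : Type*} [AddCommGroup E] [Module F E]

theorem mem_pts {P : ℙ F E} {U : Submodule F E} : P ∈ pts U ↔ P.submodule ≤ U := Iff.rfl

theorem finrank_sup_eq_two {P Q : ℙ F E} (h : P ≠ Q) :
    Module.finrank F ↥(P.submodule ⊔ Q.submodule) = 2 := by
  obtain ⟨u, hu, huP⟩ := exists_ne_zero_mem P
  obtain ⟨v, hv, hvQ⟩ := exists_ne_zero_mem Q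
  rw [submodule_eq_span hu huP, submodule_eq_span hv hvQ, ← Submodule.span_insert]
  refine finrank_span_pair fun a b hab => ?_
  have ha : a = 0 := by
    by_contra ha
    refine h (point_eq_of_mem (smul_ne_zero ha hu) (Submodule.smul_mem _ _ huP) ?_)
    rw [eq_neg_of_add_eq_zero_left hab]
    exact neg_mem (Submodule.smul_mem _ _ hvQ)
  subst ha
  rw [zero_smul, zero_add] at hab
  exact ⟨rfl, (smul_eq_zero.1 hab).resolve_right hv⟩

theorem exists_line (hd : 2 ≤ Module.finrank F E) (P Q : ℙ F E) :
    ∃ l : Submodule F E, Module.finrank F l = 2 ∧ P ∈ pts l ∧ Q ∈ pts l := by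
  by_cases h : P = Q
  · subst h
    obtain ⟨v, -, hv⟩ : ∃ v ∈ (⊤ : Submodule F E), v ∉ P.submodule := by
      by_contra! hcon
      have h1 := P.finrank_submodule
      rw [show P.submodule = ⊤ from top_le_iff.1 hcon, finrank_top] at h1
      omega
    have hv0 : v ≠ 0 := fun h0 => hv (h0 ▸ zero_mem _)
    exact ⟨P.submodule ⊔ (Projectivization.mk F v hv0).submodule,
      finrank_sup_eq_two (fun h => hv (by rw [h]; exact mem_mk hv0)), mem_pts.2 le_sup_left,
      mem_pts.2 le_sup_left⟩
  · exact ⟨_, finrank_sup_eq_two h, mem_pts.2 le_sup_left, mem_pts.2 le_sup_right⟩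

/-- Semilinearity is not needed: `R` lies in the sum of `P` and `Q`, and additivity respects sums.
-/
theorem Collinear.map_of_additive (hd : 2 ≤ Module.finrank F E) (t : E ≃+ E)
    {P Q R P' Q' R' : ℙ F E}
    (hP : ∀ v, t v ∈ P'.submodule ↔ v ∈ P.submodule)
    (hQ : ∀ v, t v ∈ Q'.submodule ↔ v ∈ Q.submodule)
    (hR : ∀ v, t v ∈ R'.submodule ↔ v ∈ R.submodule) (h : Collinear P Q R) :
    Collinear P' Q' R' := by
  obtain ⟨l, hl, hPl, hQl, hRl⟩ := h
  by_cases hPQ : P' = Q'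
  · obtain ⟨m, hm, h1, h2⟩ := exists_line hd P' R'
    exact ⟨m, hm, h1, hPQ ▸ h1, h2⟩
  have hne : P ≠ Q := by
    rintro rfl
    obtain ⟨u, hu, huP⟩ := exists_ne_zero_mem P
    exact hPQ (point_eq_of_mem (t.map_ne_zero_iff.2 hu) ((hP u).2 huP) ((hQ u).2 huP))
  have : FiniteDimensional F l := FiniteDimensional.of_finrank_pos (by omega)
  have hlPQ : P.submodule ⊔ Q.submodule = l :=
    Submodule.eq_of_le_of_finrank_eq (sup_le hPl hQl) (by rw [finrank_sup_eq_two hne, hl])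
  refine ⟨_, finrank_sup_eq_two hPQ, mem_pts.2 le_sup_left, mem_pts.2 le_sup_right, fun w hw => ?_⟩
  obtain ⟨u, rfl⟩ := t.surjective w
  have hu : u ∈ P.submodule ⊔ Q.submodule := hlPQ ▸ hRl ((hR u).1 hw)
  obtain ⟨p, hp, q, hq, rfl⟩ := Submodule.mem_sup.1 hu
  rw [map_add]
  exact Submodule.add_mem_sup ((hP p).2 hp) ((hQ q).2 hq)

/-- Rules out `n = 0`: a frame would need two points where there is only one. -/
theorem IsFrame.finrank_ne_one {A : Set (ℙ F E)} (hA : IsFrame A) : Module.finrank F E ≠ 1 := by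
  intro h
  have h2 : 1 < A.ncard := by rw [hA.2.1, h]; norm_num
  obtain ⟨P, -, Q, -, hPQ⟩ := (Set.one_lt_ncard hA.1).1 h2
  have : FiniteDimensional F E := FiniteDimensional.of_finrank_pos (by omega)
  have htop : ∀ P : ℙ F E, P.submodule = ⊤ := fun P =>
    Submodule.eq_top_of_finrank_eq (by rw [P.finrank_submodule, h])
  exact hPQ (Projectivization.submodule_injective (by rw [htop, htop]))

end Collinearity

/-! ### The theorem in affine coordinates. -/

section AffineSpace

variable {F : Type*} [Field F] {E : Type*} [AddCommGroup E] [Module F E]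

/-- A line pair contains a line minus a point, so the closure is the whole space and Property (*) is
available. -/
theorem not_hasLinePair_of_isClosure (hF : ∃ b : F, b ≠ 0 ∧ b ≠ 1) {K S : Set (ℙ F E)}
    (hS : IsClosure K S) (hK : S = Set.univ → PropertyStar K) : ¬ HasLinePair K := by
  intro h
  refine h.not_propertyStar (hK ?_)
  obtain ⟨e₁, e₂, f, hind, hl, -, -⟩ := h
  obtain ⟨-, ⟨⟨F₀, c, rfl⟩, hKS⟩, -⟩ := hS
  refine subfieldPoints_eq_univ_of_line hF (e := e₁) (f := f) (fun x y hxy => ?_) fun b => ?_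
  · obtain ⟨h1, -, h3⟩ := hind x 0 y (by rw [← hxy]; module)
    exact ⟨h1, h3⟩
  · obtain ⟨T, hT, hbT⟩ := hl b
    exact ⟨T, hKS hT, hbT⟩

/-- A bijection of the affine space mapping the lines with direction in `K` onto the lines with
direction in `K'` does the same for their closures, and preserves collinearity at infinity. -/
theorem MapsLines.exists_equiv_closure (hF : ∃ b : F, b ≠ 0 ∧ b ≠ 1)
    (hd : 2 ≤ Module.finrank F E) {K K' S S' : Set (ℙ F E)} (hS : IsClosure K S)
    (hS' : IsClosure K' S') (hK : S = Set.univ → PropertyStar K) {τ : E ≃ E}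
    (hτ : MapsLines τ K K') (hτ' : MapsLines τ.symm K' K) :
    ∃ φ : S ≃ S', (∀ (P : S) (x y : E),
        τ y - τ x ∈ (φ P : ℙ F E).submodule ↔ y - x ∈ (P : ℙ F E).submodule) ∧
      ∀ P Q R : S, Collinear (φ P : ℙ F E) (φ Q : ℙ F E) (φ R : ℙ F E) ↔
        Collinear (P : ℙ F E) (Q : ℙ F E) (R : ℙ F E) := by
  have hspan : ∀ {K S : Set (ℙ F E)}, IsClosure K S →
      ∀ P : ℙ F E, ∃ C ⊆ K, P ∉ C ∧ (⨆ Q ∈ C, Q.submodule) = ⊤ := by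
    rintro K S ⟨⟨A, hAK, hA⟩, -⟩ P
    obtain ⟨C, hCA, hPC, -, hC⟩ := hA.exists_spanning_subset P
    exact ⟨C, hCA.trans hAK, hPC, hC⟩
  have : Nontrivial E := Module.nontrivial_of_finrank_pos (R := F) (by omega)
  have htop : (⨆ P ∈ K', P.submodule) = ⊤ := by
    obtain ⟨v, hv⟩ := exists_ne (0 : E)
    obtain ⟨C, hCK, -, hC⟩ := hspan hS' (Projectivization.mk F v hv)
    rw [eq_top_iff, ← hC]
    exact biSup_mono hCK
  have hpar' : ∀ T ∈ K', ∃ P ∈ K, ∀ x y, τ y - τ x ∈ T.submodule ↔ y - x ∈ P.submodule := by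
    intro T hT
    -- Applied to the inverse, since line pairs are excluded only in `K`; the forward statement is
    -- deduced from this one.
    obtain ⟨P, hP, h⟩ := hτ'.exists_map_points hτ hF (not_hasLinePair_of_isClosure hF hS hK)
      htop hT
    refine ⟨P, hP, fun x y => ?_⟩
    rw [← h, τ.symm_apply_apply, τ.symm_apply_apply]
  have hpar : ∀ P ∈ K, ∃ T ∈ K', ∀ x y, τ y - τ x ∈ T.submodule ↔ y - x ∈ P.submodule := by
    intro P hP
    obtain ⟨T, hT, h⟩ := hτ P hP 0
    obtain ⟨P', -, h'⟩ := hpar' T hT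
    obtain ⟨u, hu, huP⟩ := exists_ne_zero_mem P
    have hPP' : P = P' := point_eq_of_mem hu huP (by
      rw [← sub_zero u, ← h', h, sub_zero]; exact huP)
    exact ⟨T, hT, hPP' ▸ h'⟩
  have hadd := map_add_sub_of_parallel (hspan hS) hpar
  have hsub : ∀ x y, τ y - τ x = τ (y - x) - τ 0 := by
    intro x y
    rw [← hadd x (y - x), add_sub_cancel]
  let t : E ≃+ E := AddEquiv.mk' (τ.trans (Equiv.subRight (τ 0))) (by
    intro x y
    simp only [Equiv.trans_apply, Equiv.subRight_apply]
    rw [← hadd x y]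
    abel)
  have ht : ∀ x y, τ y - τ x = t (y - x) := hsub
  have hto : ∀ {P T : ℙ F E}, (∀ v, t v ∈ T.submodule ↔ v ∈ P.submodule) →
      ∀ w, t.symm w ∈ P.submodule ↔ w ∈ T.submodule := by
    intro P T h w
    rw [← h, t.apply_symm_apply]
  have hKt : ∀ P ∈ K, ∃ T ∈ K', ∀ v, t v ∈ T.submodule ↔ v ∈ P.submodule := by
    intro P hP
    obtain ⟨T, hT, h⟩ := hpar P hP
    exact ⟨T, hT, fun v => by simpa [ht] using h 0 v⟩
  have hKt' : ∀ T ∈ K', ∃ P ∈ K, ∀ v, t v ∈ T.submodule ↔ v ∈ P.submodule := by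
    intro T hT
    obtain ⟨P, hP, h⟩ := hpar' T hT
    exact ⟨P, hP, fun v => by simpa [ht] using h 0 v⟩
  have hback := exists_preimage_of_isClosure hd hS hS' hKt hKt'
  have hforth := exists_preimage_of_isClosure (t := t.symm) hd hS' hS
    (fun T hT => by
      obtain ⟨P, hP, h⟩ := hKt' T hT
      exact ⟨P, hP, hto h⟩)
    (fun P hP => by
      obtain ⟨T, hT, h⟩ := hKt P hP
      exact ⟨T, hT, hto h⟩)
  have hforth' : ∀ P : S, ∃ T : S', ∀ v, t v ∈ (T : ℙ F E).submodule ↔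
      v ∈ (P : ℙ F E).submodule := by
    rintro ⟨P, hP⟩
    obtain ⟨T, hT, h⟩ := hforth P hP
    exact ⟨⟨T, hT⟩, fun v => by rw [← h, t.symm_apply_apply]⟩
  choose φ hφ using hforth'
  have hbij : Function.Bijective φ := by
    constructor
    · intro P Q hPQ
      obtain ⟨u, hu, huP⟩ := exists_ne_zero_mem P.1
      exact Subtype.ext (point_eq_of_mem hu huP (by rw [← hφ, ← hPQ, hφ]; exact huP))
    · rintro ⟨T, hT⟩
      obtain ⟨P, hP, h⟩ := hback T hT
      refine ⟨⟨P, hP⟩, Subtype.ext ?_⟩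
      obtain ⟨u, hu, huP⟩ := exists_ne_zero_mem P
      exact point_eq_of_mem (t.map_ne_zero_iff.2 hu) ((hφ _ u).2 huP) ((h u).2 huP)
  refine ⟨Equiv.ofBijective φ hbij, fun P x y => ?_, fun P Q R => ⟨?_, ?_⟩⟩
  · rw [ht]; exact hφ P _
  · exact Collinear.map_of_additive hd t.symm (hto (hφ P)) (hto (hφ Q)) (hto (hφ R))
  · exact Collinear.map_of_additive hd t (hφ P) (hφ Q) (hφ R)

end AffineSpace

/-! ### Affine coordinates off the hyperplane. -/

section Coordinates

variable {F : Type*} [Field F] {V : Type*} [AddCommGroup V] [Module F V] {H : Submodule F V}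
  {v₀ : V}

theorem exists_complement [FiniteDimensional F V]
    (h : Module.finrank F V = Module.finrank F H + 1) :
    ∃ v₀ ∉ H, ∀ v, ∃ c : F, v - c • v₀ ∈ H := by
  obtain ⟨v₀, hv₀⟩ : ∃ v₀, v₀ ∉ H := by
    by_contra! hcon
    rw [Submodule.eq_top_iff'.2 hcon, finrank_top] at h
    omega
  have hlt : H < H ⊔ Submodule.span F {v₀} :=
    lt_of_le_of_ne le_sup_left fun heq => hv₀ (by
      rw [heq]; exact Submodule.mem_sup_right (Submodule.mem_span_singleton_self _))
  have htop : H ⊔ Submodule.span F {v₀} = ⊤ := by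
    apply Submodule.eq_top_of_finrank_eq
    have h1 := Submodule.finrank_lt_finrank_of_lt hlt
    have h2 := Submodule.finrank_le (H ⊔ Submodule.span F {v₀})
    omega
  refine ⟨v₀, hv₀, fun v => ?_⟩
  have hv : v ∈ H ⊔ Submodule.span F {v₀} := by rw [htop]; trivial
  obtain ⟨h, hh, w, hw, rfl⟩ := Submodule.mem_sup.1 hv
  obtain ⟨c, rfl⟩ := Submodule.mem_span_singleton.1 hw
  exact ⟨c, by rwa [add_sub_cancel_right]⟩

theorem add_notMem (hv₀ : v₀ ∉ H) (x : H) : v₀ + x ∉ H := fun h =>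
  hv₀ ((Submodule.add_mem_iff_left H x.2).1 h)

theorem add_ne_zero_of_notMem (hv₀ : v₀ ∉ H) (x : H) : v₀ + (x : V) ≠ 0 := fun h =>
  add_notMem hv₀ x (h ▸ zero_mem H)

/-- The affine point with affine coordinate vector `x`. -/
def affinePoint (hv₀ : v₀ ∉ H) (x : H) : AffinePoint H :=
  ⟨Projectivization.mk F (v₀ + x) (add_ne_zero_of_notMem hv₀ x),
    fun h => add_notMem hv₀ x (h (mem_mk _))⟩

theorem affinePoint_mem_pts (hv₀ : v₀ ∉ H) (x : H) (L : Submodule F V) :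
    (affinePoint hv₀ x).1 ∈ pts L ↔ v₀ + x ∈ L := by
  rw [affinePoint, pts, Set.mem_ofPred_eq, Projectivization.submodule_mk,
    Submodule.span_singleton_le_iff_mem]

theorem affinePoint_bijective (hv₀ : v₀ ∉ H) (hH : ∀ v, ∃ c : F, v - c • v₀ ∈ H) :
    Function.Bijective (affinePoint hv₀) := by
  constructor
  · intro x y hxy
    have h1 := (Projectivization.mk_eq_mk_iff' F _ _ _ _).1 (congrArg Subtype.val hxy)
    obtain ⟨a, ha⟩ := h1
    have h2 : (1 - a) • v₀ = a • (y : V) - x := by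
      rw [eq_sub_iff_add_eq, sub_smul, one_smul, sub_add_eq_add_sub, ← ha, smul_add]
      abel
    have ha1 : a = 1 := by
      by_contra hne
      apply hv₀
      rw [← Submodule.smul_mem_iff H (sub_ne_zero.2 (Ne.symm hne)), h2]
      exact sub_mem (Submodule.smul_mem _ _ y.2) x.2
    rw [ha1, one_smul] at ha
    exact Subtype.ext (add_left_cancel ha).symm
  · rintro ⟨p, hp⟩
    obtain ⟨v, hv, hvp⟩ := exists_ne_zero_mem p
    obtain ⟨c, hc⟩ := hH v
    have hc0 : c ≠ 0 := by
      rintro rfl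
      rw [zero_smul, sub_zero] at hc
      apply hp
      rw [pts, Set.mem_ofPred_eq, submodule_eq_span hv hvp, Submodule.span_singleton_le_iff_mem]
      exact hc
    refine ⟨⟨_, Submodule.smul_mem _ c⁻¹ hc⟩, Subtype.ext ?_⟩
    refine point_eq_of_mem (add_ne_zero_of_notMem hv₀ _) (mem_mk _) ?_
    have : v₀ + c⁻¹ • (v - c • v₀) = c⁻¹ • v := by
      rw [smul_sub, smul_smul, inv_mul_cancel₀ hc0, one_smul, add_sub_cancel]
    rw [this]
    exact Submodule.smul_mem _ _ hvp

theorem MeetsInfinityAt.mem_iff {L : Submodule F V} {P : ℙ F H} (h : MeetsInfinityAt H L P)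
    (x : H) : (x : V) ∈ L ↔ x ∈ P.submodule := by
  have h1 : (x : V) ∈ L ⊓ H ↔ (x : V) ∈ P.submodule.map H.subtype := by
    rw [show L ⊓ H = _ from h]
  rw [Submodule.mem_inf, and_iff_left x.2, Submodule.mem_map] at h1
  rw [h1]
  constructor
  · rintro ⟨y, hy, hyx⟩
    rwa [← Subtype.ext (a1 := y) hyx]
  · exact fun hx => ⟨x, hx, rfl⟩

theorem MeetsInfinityAt.unique {L : Submodule F V} {P Q : ℙ F H} (hP : MeetsInfinityAt H L P)
    (hQ : MeetsInfinityAt H L Q) : P = Q := by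
  obtain ⟨u, hu, huP⟩ := exists_ne_zero_mem P
  exact point_eq_of_mem hu huP ((hQ.mem_iff u).1 ((hP.mem_iff u).2 huP))

/-- In affine coordinates a line is a coset of its point at infinity. -/
theorem MeetsInfinityAt.add_mem_iff {L : Submodule F V} {P : ℙ F H}
    (h : MeetsInfinityAt H L P) {x : H} (hx : v₀ + x ∈ L) (y : H) :
    v₀ + y ∈ L ↔ y - x ∈ P.submodule := by
  rw [← h.mem_iff, ← Submodule.sub_mem_iff_left L hx, add_sub_add_left_eq_sub]
  rfl

theorem exists_add_mem (hH : ∀ v, ∃ c : F, v - c • v₀ ∈ H)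
    {L : Submodule F V} (hL : Module.finrank F L = 2) {P : ℙ F H} (h : MeetsInfinityAt H L P) :
    ∃ x : H, v₀ + x ∈ L := by
  obtain ⟨v, hvL, hvH⟩ : ∃ v ∈ L, v ∉ H := by
    by_contra! hcon
    have h1 : L ⊓ H = L := inf_eq_left.2 hcon
    rw [show L ⊓ H = _ from h] at h1
    rw [← h1, Submodule.finrank_map_subtype_eq, P.finrank_submodule] at hL
    omega
  obtain ⟨c, hc⟩ := hH v
  have hc0 : c ≠ 0 := by
    rintro rfl
    rw [zero_smul, sub_zero] at hc
    exact hvH hc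
  refine ⟨⟨_, Submodule.smul_mem _ c⁻¹ hc⟩, ?_⟩
  have : v₀ + c⁻¹ • (v - c • v₀) = c⁻¹ • v := by
    rw [smul_sub, smul_smul, inv_mul_cancel₀ hc0, one_smul, add_sub_cancel]
  rw [this]
  exact Submodule.smul_mem _ _ hvL

/-- There is a line through each affine point with each direction. -/
theorem exists_meetsInfinityAt (hv₀ : v₀ ∉ H) (P : ℙ F H) (x : H) :
    ∃ L : Submodule F V, Module.finrank F L = 2 ∧ MeetsInfinityAt H L P ∧ v₀ + x ∈ L := by
  obtain ⟨u, hu, huP⟩ := exists_ne_zero_mem P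
  refine ⟨Submodule.span F {v₀ + x, (u : V)}, finrank_span_pair fun a b hab => ?_, ?_,
    Submodule.subset_span (by simp)⟩
  · have ha : a = 0 := by
      by_contra ha
      apply add_notMem hv₀ x
      rw [← Submodule.smul_mem_iff H ha, eq_neg_of_add_eq_zero_left hab]
      exact neg_mem (Submodule.smul_mem _ _ u.2)
    subst ha
    rw [zero_smul, zero_add] at hab
    exact ⟨rfl, (smul_eq_zero.1 hab).resolve_right (fun h => hu (Subtype.ext h))⟩
  · ext w
    rw [Submodule.mem_inf, Submodule.mem_span_pair, Submodule.mem_map]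
    constructor
    · rintro ⟨⟨a, b, rfl⟩, hw⟩
      have ha : a = 0 := by
        by_contra ha
        apply add_notMem hv₀ x
        rw [← Submodule.smul_mem_iff H ha]
        exact (Submodule.add_mem_iff_left H (Submodule.smul_mem _ _ u.2)).1 hw
      exact ⟨b • u, Submodule.smul_mem _ _ huP, by rw [ha]; simp⟩
    · rintro ⟨y, hy, rfl⟩
      obtain ⟨c, rfl⟩ := (mem_submodule_iff_smul hu huP).1 hy
      exact ⟨⟨0, c, by simp⟩, (c • u).2⟩

/-- A line meeting infinity in one point is determined by its affine points. -/
theorem line_ext (hH : ∀ v, ∃ c : F, v - c • v₀ ∈ H) {L M : Submodule F V}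
    (hL : ∃ x : H, v₀ + x ∈ L) (hM : ∃ x : H, v₀ + x ∈ M)
    (h : ∀ y : H, v₀ + y ∈ L ↔ v₀ + y ∈ M) : L = M := by
  have key : ∀ {L M : Submodule F V}, (∃ x : H, v₀ + x ∈ L) →
      (∀ y : H, v₀ + y ∈ L ↔ v₀ + y ∈ M) → L ≤ M := by
    rintro L M ⟨x, hx⟩ h v hv
    obtain ⟨c, hc⟩ := hH v
    -- Subtracting a multiple of `v₀ + x` moves `v` into `H`, so this sum is the vector of an affine
    -- point.
    have h1 : (v₀ + x) + (v - c • (v₀ + x)) ∈ M := by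
      have : (v₀ + x) + (v - c • (v₀ + x)) = v₀ + ((x + ⟨_, hc⟩ - c • x : H) : V) := by
        push_cast
        module
      rw [this, ← h, ← this]
      exact add_mem hx (sub_mem hv (Submodule.smul_mem _ _ hx))
    have hxM := (h x).1 hx
    have h2 := (Submodule.add_mem_iff_right M hxM).1 h1
    exact (Submodule.sub_mem_iff_left M (Submodule.smul_mem _ _ hxM)).1 h2
  exact (key hL h).antisymm (key hM fun y => (h y).symm)

end Coordinates

/-! ### Isomorphisms as bijections of affine space. -/

section LinearRepresentations

variable {F : Type*} [Field F] {V : Type*} [AddCommGroup V] [Module F V] {H : Submodule F V}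
  {v₀ : V}

theorem RepLine.exists_add_mem (hH : ∀ v, ∃ c : F, v - c • v₀ ∈ H) {K : Set (ℙ F H)}
    (L : RepLine H K) : ∃ x : H, v₀ + x ∈ L.1 := by
  obtain ⟨P, -, h⟩ := L.2.2
  exact LinRep.exists_add_mem hH L.2.1 h

theorem inc_affinePoint (hv₀ : v₀ ∉ H) {K : Set (ℙ F H)} (x : H) (L : RepLine H K) :
    Inc H K (affinePoint hv₀ x) L ↔ v₀ + x ∈ L.1 :=
  affinePoint_mem_pts hv₀ x L.1

theorem RepLine.ext_of_inc (hv₀ : v₀ ∉ H) (hH : ∀ v, ∃ c : F, v - c • v₀ ∈ H)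
    {K K' : Set (ℙ F H)} {L : RepLine H K} {M : RepLine H K'}
    (h : ∀ p, Inc H K p L ↔ Inc H K' p M) : L.1 = M.1 :=
  line_ext hH (L.exists_add_mem hH) (M.exists_add_mem hH) fun y => by
    rw [← inc_affinePoint hv₀, ← inc_affinePoint hv₀]; exact h _

/-- The inverse of an isomorphism of incidence structures. -/
def IncidenceIso.symm {P L P' L' : Type*} {I : P → L → Prop} {I' : P' → L' → Prop}
    (γ : IncidenceIso I I') : IncidenceIso I' I where
  onPoints := γ.onPoints.symm
  onLines := γ.onLines.symm
  inc_iff p l := by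
    rw [← γ.inc_iff, Equiv.apply_symm_apply, Equiv.apply_symm_apply]

theorem mapsLines_of_linRepIso (hv₀ : v₀ ∉ H)
    {K K' : Set (ℙ F H)} (γ : LinRepIso H K K') {σ : H ≃ H}
    (hσ : ∀ x, affinePoint hv₀ (σ x) = γ.onPoints (affinePoint hv₀ x)) : MapsLines σ K K' := by
  intro P hP x
  obtain ⟨L, hL2, hLP, hxL⟩ := exists_meetsInfinityAt hv₀ P x
  let M : RepLine H K := ⟨L, hL2, P, hP, hLP⟩
  obtain ⟨T, hT, hMT⟩ := (γ.onLines M).2.2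
  have hinc : ∀ y, v₀ + (σ y : V) ∈ (γ.onLines M).1 ↔ v₀ + y ∈ L := by
    intro y
    rw [← inc_affinePoint hv₀, hσ, γ.inc_iff, inc_affinePoint]
  refine ⟨T, hT, fun y => ?_⟩
  rw [← hMT.add_mem_iff ((hinc x).2 hxL), hinc, hLP.add_mem_iff hxL]

theorem exists_repLine_image (hv₀ : v₀ ∉ H) (hH : ∀ v, ∃ c : F, v - c • v₀ ∈ H)
    {S S' : Set (ℙ F H)} {σ : H ≃ H} (hσ : MapsLines σ S S') (L : RepLine H S) :
    ∃ M : RepLine H S', ∀ y, v₀ + (σ y : V) ∈ M.1 ↔ v₀ + y ∈ L.1 := by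
  obtain ⟨x, hx⟩ := L.exists_add_mem hH
  obtain ⟨P, hP, hLP⟩ := L.2.2
  obtain ⟨T, hT, h⟩ := hσ P hP x
  obtain ⟨M, hM2, hMT, hxM⟩ := exists_meetsInfinityAt hv₀ T (σ x)
  refine ⟨⟨M, hM2, T, hT, hMT⟩, fun y => ?_⟩
  rw [hMT.add_mem_iff hxM, hLP.add_mem_iff hx, h]

/-- A bijection of the affine points mapping lines to lines in both directions is an
isomorphism of linear representations. -/
theorem exists_linRepIso (hv₀ : v₀ ∉ H) (hH : ∀ v, ∃ c : F, v - c • v₀ ∈ H)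
    {S S' : Set (ℙ F H)} {σ : H ≃ H} (hσ : MapsLines σ S S') (hσ' : MapsLines σ.symm S' S)
    (e : AffinePoint H ≃ AffinePoint H)
    (he : ∀ x, affinePoint hv₀ (σ x) = e (affinePoint hv₀ x)) :
    ∃ δ : LinRepIso H S S', δ.onPoints = e := by
  choose f hf using exists_repLine_image hv₀ hH hσ
  choose g hg using exists_repLine_image hv₀ hH hσ'
  refine ⟨⟨e, ⟨f, g, fun L => Subtype.ext ?_, fun M => Subtype.ext ?_⟩, fun p L => ?_⟩, rfl⟩
  · refine line_ext hH ((g (f L)).exists_add_mem hH) (L.exists_add_mem hH) fun y => ?_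
    rw [← hf L y, ← hg (f L) (σ y), σ.symm_apply_apply]
  · refine line_ext hH ((f (g M)).exists_add_mem hH) (M.exists_add_mem hH) fun y => ?_
    rw [← hg M y, ← hf (g M) (σ.symm y), σ.apply_symm_apply]
  · obtain ⟨x, rfl⟩ := (affinePoint_bijective hv₀ hH).2 p
    rw [← he, inc_affinePoint, inc_affinePoint]
    exact hf L x

end LinearRepresentations

end LinRep

/-! ### Conclusion for linear representations. -/

theorem mainTheorem3 {F : Type*} [Field F] [Finite F] (hq : 2 < Nat.card F)
    {V : Type*} [AddCommGroup V] [Module F V] (n : ℕ) (hV : Module.finrank F V = n + 2)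
    (H : Submodule F V) (hH : Module.finrank F H = n + 1)
    (K K' S S' : Set (ℙ F H)) (hS : LinRep.IsClosure K S) (hS' : LinRep.IsClosure K' S')
    (hK : S = Set.univ → LinRep.PropertyStar K)
    (γ : LinRep.LinRepIso H K K') :
    ∃ δ : LinRep.LinRepIso H S S', LinRep.IsInducedBy γ δ ∧ LinRep.MapsInfinityOnto δ := by
  open LinRep in
  have hF : ∃ b : F, b ≠ 0 ∧ b ≠ 1 := by
    by_contra! hcon
    have hle : (Set.univ : Set F).ncard ≤ ({0, 1} : Set F).ncard :=
      Set.ncard_le_ncard (fun b _ => by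
        by_cases hb : b = 0
        · exact Or.inl hb
        · exact Or.inr (hcon b hb)) (Set.toFinite _)
    rw [Set.ncard_univ, Set.ncard_pair zero_ne_one] at hle
    omega
  have hd : 2 ≤ Module.finrank F H := by
    obtain ⟨⟨A, -, hA⟩, -⟩ := hS
    have := hA.finrank_ne_one
    omega
  have : FiniteDimensional F V := FiniteDimensional.of_finrank_pos (by omega)
  obtain ⟨v₀, hv₀, hc⟩ := exists_complement (H := H) (by omega)
  let pt := Equiv.ofBijective _ (affinePoint_bijective hv₀ hc)
  let σ : H ≃ H := (pt.trans γ.onPoints).trans pt.symm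
  have hσ : ∀ x, affinePoint hv₀ (σ x) = γ.onPoints (affinePoint hv₀ x) := fun x =>
    pt.apply_symm_apply _
  have hτ : MapsLines σ K K' := mapsLines_of_linRepIso hv₀ γ hσ
  have hτ' : MapsLines σ.symm K' K := mapsLines_of_linRepIso hv₀ γ.symm fun x =>
    (γ.onPoints.eq_symm_apply).2 (by rw [← hσ, σ.apply_symm_apply])
  obtain ⟨φ, hφ, hcol⟩ := hτ.exists_equiv_closure hF hd hS hS' hK hτ'
  obtain ⟨δ, hδ⟩ := exists_linRepIso hv₀ hc (S := S) (S' := S') (σ := σ)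
    (fun P hP x => ⟨φ ⟨P, hP⟩, (φ ⟨P, hP⟩).2, hφ ⟨P, hP⟩ x⟩)
    (fun T hT x => ⟨φ.symm ⟨T, hT⟩, (φ.symm ⟨T, hT⟩).2, fun y => by
      rw [← hφ, φ.apply_symm_apply, σ.apply_symm_apply, σ.apply_symm_apply]⟩)
    γ.onPoints hσ
  refine ⟨δ, ⟨fun p => by rw [hδ], fun L => ?_⟩, φ, fun L P => ?_, hcol⟩
  · obtain ⟨hL2, P, hP, hLP⟩ := L.2
    refine ⟨⟨L.1, hL2, P, hS.2.1.2 hP, hLP⟩, rfl, ?_⟩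
    refine RepLine.ext_of_inc hv₀ hc fun p => ?_
    obtain ⟨p, rfl⟩ := γ.onPoints.surjective p
    rw [γ.inc_iff, ← hδ]
    exact δ.inc_iff p _
  · obtain ⟨x, hx⟩ := L.exists_add_mem hc
    obtain ⟨Q, hQ, hLQ⟩ := L.2.2
    obtain ⟨T, hT, hMT⟩ := (δ.onLines L).2.2
    have hinc : ∀ y, v₀ + (σ y : V) ∈ (δ.onLines L).1 ↔ v₀ + (y : V) ∈ L.1 := by
      intro y
      rw [← inc_affinePoint hv₀, hσ, ← hδ, δ.inc_iff, inc_affinePoint]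
    -- The image line has some direction `T`; one further point on it identifies `T` through the
    -- behaviour of `φ` on differences.
    have hTQ : T = φ ⟨Q, hQ⟩ := by
      obtain ⟨u, hu, huT⟩ := exists_ne_zero_mem T
      refine point_eq_of_mem hu huT ?_
      have h1 := (hMT.add_mem_iff ((hinc x).2 hx) (σ x + u)).2 (by rwa [add_sub_cancel_left])
      obtain ⟨y, hy⟩ := σ.surjective (σ x + u)
      rw [← hy, hinc, hLQ.add_mem_iff hx, ← hφ ⟨Q, hQ⟩, hy, add_sub_cancel_left] at h1
      exact h1
    constructor
    · intro h
      have : P = ⟨Q, hQ⟩ := φ.injective (Subtype.ext ((h.unique hMT).trans hTQ))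
      rw [this]; exact hLQ
    · intro h
      have : P = ⟨Q, hQ⟩ := Subtype.ext (h.unique hLQ)
      rw [this, ← hTQ]; exact hMT
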